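/- Let $n\ge 0$ and $k\ge 1$ ($k=\infty$ is allowed), and let $A\in\mathcal C^k([0,1],\mathbb C^{n\times n})$ have distinct, nonzero singular values $\sigma_1(t)>\dots>\sigma_n(t)>0$ for all $t\in[0,1]$. By a $\mathcal C^m$ singular value decomposition (SVD) of $A$ we mean $A(t)=U(t)\Sigma(t)V(t)^*$, $t\in[0,1]$, with $U,\Sigma,V$ of class $\mathcal C^m$ on $[0,1]$, $U(t),V(t)$ unitary and $\Sigma(t)=\operatorname{diag}(\sigma_1(t),\dots,\sigma_n(t))$, the diagonal entries being real, nonnegative and in decreasing order. (a) Given any SVD $A(0)=U_0\Sigma_0V_0^*$ at $t=0$, there is exactly one $\mathcal C^k$ SVD $A=U\Sigma V^*$ on $[0,1]$ with $U(0)=U_0$, $\Sigma(0)=\Sigma_0$, $V(0)=V_0$ whose pair $(U,V)$ minimizes $$\int_0^1\sqrt{\|\dot U(t)\|_{\mathrm F}^2+\|\dot V(t)\|_{\mathrm F}^2}\,dt$$ among all $\mathcal C^1$ SVDs of $A$ on $[0,1]$ (with arbitrary initial factors). A $\mathcal C^k$ SVD with this minimizing property is called a joint minimum variation decomposition (joint-MVD).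 (b) A $\mathcal C^k$ SVD $A=U\Sigma V^*$ on $[0,1]$ is a joint-MVD if and only if there are matrix functions $H,K$ on $[0,1]$ which satisfy the SVD differential equations $$\dot\Sigma=U^*\dot AV-H\Sigma+\Sigma K,\qquad \dot U=UH,\qquad \dot V=VK,$$ where $H(t),K(t)$ are skew-Hermitian and, with $F=U^*\dot AV$, $$H_{j\ell}=\frac{\sigma_\ell F_{j\ell}+\sigma_j\overline{F_{\ell j}}}{\sigma_\ell^2-\sigma_j^2},\qquad K_{j\ell}=\frac{\sigma_\ell\overline{F_{\ell j}}+\sigma_jF_{j\ell}}{\sigma_\ell^2-\sigma_j^2}\quad(j\ne\ell),\qquad H_{jj}-K_{jj}=\frac{i\,\operatorname{Im}F_{jj}}{\sigma_j},$$ and which in addition satisfy $H_{jj}(t)+K_{jj}(t)=0$ for all $t\in[0,1]$ and $j=1,\dots,n$. -/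

import Mathlib

open Set Matrix

/-! Square complex matrices carry the Frobenius norm throughout. -/
attribute [local instance] Matrix.frobeniusNormedAddCommGroup Matrix.frobeniusNormedSpace

noncomputable section

/-- The singular values `σ₁ ≥ ⋯ ≥ σₙ` of a square complex matrix, in decreasing order and with
multiplicity: those of the linear map on `ℂⁿ` (Euclidean norm) that the matrix represents. -/
def singularValue {n : ℕ} (A : Matrix (Fin n) (Fin n) ℂ) (j : Fin n) : ℝ :=
  (Matrix.toEuclideanLin A).singularValues j

/-- The matrix `Σ = diag(σ₁, …, σₙ)`, as a complex matrix. -/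
def sigmaMatrix {n : ℕ} (σ : Fin n → ℝ) : Matrix (Fin n) (Fin n) ℂ :=
  Matrix.diagonal fun j => (σ j : ℂ)

/-- `A = U Σ V*` is a singular value decomposition: `U`, `V` are unitary and
`Σ = diag(σ₁, …, σₙ)` with `σ₁ ≥ ⋯ ≥ σₙ ≥ 0`. -/
structure IsSVD {n : ℕ} (A U : Matrix (Fin n) (Fin n) ℂ) (σ : Fin n → ℝ)
    (V : Matrix (Fin n) (Fin n) ℂ) : Prop where
  unitary_left : U ∈ Matrix.unitaryGroup (Fin n) ℂ
  unitary_right : V ∈ Matrix.unitaryGroup (Fin n) ℂ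
  nonneg : ∀ j, 0 ≤ σ j
  antitone : Antitone σ
  eq : A = U * sigmaMatrix σ * Vᴴ

/-- `A(t) = U(t) Σ(t) V(t)*`, `t ∈ [0,1]`, is a `C^k` singular value decomposition. -/
structure IsSVDPath {n : ℕ} (k : ℕ∞) (A U : ℝ → Matrix (Fin n) (Fin n) ℂ)
    (σ : ℝ → Fin n → ℝ) (V : ℝ → Matrix (Fin n) (Fin n) ℂ) : Prop where
  contDiffOn_left : ContDiffOn ℝ k U (Icc 0 1)
  contDiffOn_sigma : ContDiffOn ℝ k σ (Icc 0 1)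
  contDiffOn_right : ContDiffOn ℝ k V (Icc 0 1)
  isSVD : ∀ t ∈ Icc (0 : ℝ) 1, IsSVD (A t) (U t) (σ t) (V t)

/-- The joint variation `∫₀¹ √(‖U'(t)‖_F² + ‖V'(t)‖_F²) dt`; derivatives at the endpoints of
`[0,1]` are one-sided. -/
def jointVariation {n : ℕ} (U V : ℝ → Matrix (Fin n) (Fin n) ℂ) : ℝ :=
  ∫ t in (0 : ℝ)..1,
    √(‖derivWithin U (Icc 0 1) t‖ ^ 2 + ‖derivWithin V (Icc 0 1) t‖ ^ 2)

/-- A `C^k` joint minimum variation decomposition of `A`: a `C^k` singular value decomposition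
whose unitary factors minimize the joint variation among all continuously differentiable singular
value decompositions of `A` over `[0,1]` (with arbitrary initial factors). -/
def IsJointMVD {n : ℕ} (k : ℕ∞) (A U : ℝ → Matrix (Fin n) (Fin n) ℂ)
    (σ : ℝ → Fin n → ℝ) (V : ℝ → Matrix (Fin n) (Fin n) ℂ) : Prop :=
  IsSVDPath k A U σ V ∧
    ∀ (P : ℝ → Matrix (Fin n) (Fin n) ℂ) (τ : ℝ → Fin n → ℝ)
      (Q : ℝ → Matrix (Fin n) (Fin n) ℂ),
      IsSVDPath 1 A P τ Q → jointVariation U V ≤ jointVariation P Q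

/-- The matrix `U(t)* A'(t) V(t)`. -/
def svdDrive {n : ℕ} (A U V : ℝ → Matrix (Fin n) (Fin n) ℂ) (t : ℝ) :
    Matrix (Fin n) (Fin n) ℂ :=
  (U t)ᴴ * derivWithin A (Icc 0 1) t * V t

/-- The differential-algebraic equations of a smooth singular value decomposition on `[0,1]`:
`Σ' = U*A'V - HΣ + ΣK`, `U' = UH`, `V' = VK`, with `H`, `K` skew-Hermitian, their off-diagonal
entries given in terms of `U*A'V` and the singular values, and the differences of their diagonal
entries prescribed. -/
structure SVDEquations {n : ℕ} (A U : ℝ → Matrix (Fin n) (Fin n) ℂ)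
    (σ : ℝ → Fin n → ℝ) (V H K : ℝ → Matrix (Fin n) (Fin n) ℂ) : Prop where
  deriv_sigma : ∀ t ∈ Icc (0 : ℝ) 1,
    HasDerivWithinAt (fun s => sigmaMatrix (σ s))
      (svdDrive A U V t - H t * sigmaMatrix (σ t) + sigmaMatrix (σ t) * K t) (Icc 0 1) t
  deriv_left : ∀ t ∈ Icc (0 : ℝ) 1, HasDerivWithinAt U (U t * H t) (Icc 0 1) t
  deriv_right : ∀ t ∈ Icc (0 : ℝ) 1, HasDerivWithinAt V (V t * K t) (Icc 0 1) t
  skew_left : ∀ t ∈ Icc (0 : ℝ) 1, (H t)ᴴ = -H t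
  skew_right : ∀ t ∈ Icc (0 : ℝ) 1, (K t)ᴴ = -K t
  offdiag_left : ∀ t ∈ Icc (0 : ℝ) 1, ∀ j l, j ≠ l →
    H t j l = (σ t l * svdDrive A U V t j l + σ t j * star (svdDrive A U V t l j)) /
      ((σ t l : ℂ) ^ 2 - (σ t j : ℂ) ^ 2)
  offdiag_right : ∀ t ∈ Icc (0 : ℝ) 1, ∀ j l, j ≠ l →
    K t j l = (σ t l * star (svdDrive A U V t l j) + σ t j * svdDrive A U V t j l) /
      ((σ t l : ℂ) ^ 2 - (σ t j : ℂ) ^ 2)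
  diag_sub : ∀ t ∈ Icc (0 : ℝ) 1, ∀ j,
    H t j j - K t j j = Complex.I * ((svdDrive A U V t j j).im : ℂ) / (σ t j : ℂ)

end

/-! Because the singular values are simple and positive, two decompositions of `A t` differ only by
a common diagonal unitary factor (`IsSVD.exists_phase`). Put H = U*U' and K = V*V'. Differentiating
A = UΣV* expresses the off-diagonal entries of H and K, and the differences H_jj - K_jj, through
U*A'V and Σ (`IsSVDPath.svdEquations`). A change of phase therefore keeps the moduli of the
off-diagonal entries and the diagonal differences. Only the sums H_jj + K_jj are free.

By unitary invariance of the Frobenius norm, the squared integrand is ‖H‖² + ‖K‖². The parallelogram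
law on each diagonal pair splits it into a part common to all decompositions of A and ½ ∑ |H_jj +
K_jj|² (`two_mul_norm_sq_add_norm_sq_sub_eq`, `IsSVDPath.jointSpeed_sq`). A balanced decomposition,
with all sums zero, thus minimizes the integrand pointwise. By continuity a decomposition unbalanced
at a single t has strictly larger integral, so the minimizers are exactly the balanced
decompositions.

For existence, the implicit function theorem makes the singular values C^k. A linear ODE transports
the spectral projections of A*A and yields V, and U = AVΣ⁻¹ (`exists_isSVDPath`). A diagonal phase
solving a linear ODE with C^{k-1} coefficients, hence itself C^k, then cancels the sums
(`IsSVDPath.exists_isBalanced`). For uniqueness, the phase between two balanced decompositions is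
constant (`IsSVDPath.eqOn_of_isBalanced`). -/

noncomputable section

/-! ### Entrywise calculus of matrix paths and the Frobenius norm. -/

section MatrixCalculus

variable {n : ℕ} {s : Set ℝ} {t : ℝ}

/-- Reading off the entries of a matrix, as a real-linear homeomorphism. -/
def matrixEntriesCLE (n : ℕ) : Matrix (Fin n) (Fin n) ℂ ≃L[ℝ] (Fin n → Fin n → ℂ) :=
  (Matrix.ofLinearEquiv ℝ).symm.toContinuousLinearEquiv

theorem contDiffOn_matrix_iff {m : WithTop ℕ∞} {E : Type*} [NormedAddCommGroup E]
    [NormedSpace ℝ E] {s : Set E} {M : E → Matrix (Fin n) (Fin n) ℂ} :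
    ContDiffOn ℝ m M s ↔ ∀ i j, ContDiffOn ℝ m (fun t => M t i j) s := by
  rw [← (matrixEntriesCLE n).comp_contDiffOn_iff, contDiffOn_pi]
  simp only [contDiffOn_pi]
  rfl

theorem hasDerivWithinAt_matrix_iff {M : ℝ → Matrix (Fin n) (Fin n) ℂ}
    {M' : Matrix (Fin n) (Fin n) ℂ} :
    HasDerivWithinAt M M' s t ↔ ∀ i j, HasDerivWithinAt (fun t => M t i j) (M' i j) s t :=
  (hasDerivWithinAt_pi (φ := M) (φ' := M') (E' := fun _ => Fin n → ℂ)).trans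
    (forall_congr' fun _ => hasDerivWithinAt_pi)

theorem ContDiffOn.matrix_mul {m : WithTop ℕ∞} {M N : ℝ → Matrix (Fin n) (Fin n) ℂ}
    (hM : ContDiffOn ℝ m M s) (hN : ContDiffOn ℝ m N s) :
    ContDiffOn ℝ m (fun t => M t * N t) s := by
  rw [contDiffOn_matrix_iff] at *
  intro i j
  simp only [Matrix.mul_apply]
  exact ContDiffOn.sum fun l _ => (hM i l).mul (hN l j)

theorem ContDiffOn.matrix_conjTranspose {m : WithTop ℕ∞} {M : ℝ → Matrix (Fin n) (Fin n) ℂ}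
    (hM : ContDiffOn ℝ m M s) : ContDiffOn ℝ m (fun t => (M t)ᴴ) s := by
  rw [contDiffOn_matrix_iff] at *
  intro i j
  exact (starL' ℝ : ℂ ≃L[ℝ] ℂ).contDiff.comp_contDiffOn (hM j i)

theorem ContDiffOn.matrix_diagonal {m : WithTop ℕ∞} {d : ℝ → Fin n → ℂ}
    (hd : ∀ j, ContDiffOn ℝ m (fun t => d t j) s) :
    ContDiffOn ℝ m (fun t => Matrix.diagonal (d t)) s := by
  rw [contDiffOn_matrix_iff]
  intro i j
  by_cases h : i = j
  · subst h; simpa using hd i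
  · simpa [Matrix.diagonal_apply_ne _ h] using contDiffOn_const

theorem HasDerivWithinAt.matrix_mul {M N : ℝ → Matrix (Fin n) (Fin n) ℂ}
    {M' N' : Matrix (Fin n) (Fin n) ℂ}
    (hM : HasDerivWithinAt M M' s t) (hN : HasDerivWithinAt N N' s t) :
    HasDerivWithinAt (fun t => M t * N t) (M' * N t + M t * N') s t := by
  rw [hasDerivWithinAt_matrix_iff] at *
  intro i j
  simp only [Matrix.mul_apply, Matrix.add_apply, ← Finset.sum_add_distrib]
  exact HasDerivWithinAt.fun_sum fun l _ => (hM i l).mul (hN l j)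

theorem HasDerivWithinAt.matrix_conjTranspose {M : ℝ → Matrix (Fin n) (Fin n) ℂ}
    {M' : Matrix (Fin n) (Fin n) ℂ} (hM : HasDerivWithinAt M M' s t) :
    HasDerivWithinAt (fun t => (M t)ᴴ) M'ᴴ s t := by
  rw [hasDerivWithinAt_matrix_iff] at *
  intro i j
  exact (hM j i).star

theorem ContDiffOn.sigmaMatrix {m : WithTop ℕ∞} {σ : ℝ → Fin n → ℝ}
    (hσ : ContDiffOn ℝ m σ s) : ContDiffOn ℝ m (fun t => sigmaMatrix (σ t)) s :=
  ContDiffOn.matrix_diagonal fun j =>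
    Complex.ofRealCLM.contDiff.comp_contDiffOn (contDiffOn_pi.1 hσ j)

theorem HasDerivWithinAt.sigmaMatrix {σ : ℝ → Fin n → ℝ} {σ' : Fin n → ℝ}
    (hσ : HasDerivWithinAt σ σ' s t) :
    HasDerivWithinAt (fun t => sigmaMatrix (σ t)) (sigmaMatrix σ') s t := by
  rw [hasDerivWithinAt_matrix_iff]
  intro i j
  by_cases h : i = j
  · subst h; simpa [_root_.sigmaMatrix] using (hasDerivWithinAt_pi.1 hσ i).ofReal_comp
  · simpa [_root_.sigmaMatrix, Matrix.diagonal_apply_ne _ h] using hasDerivWithinAt_const _ _ _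

theorem frobenius_norm_sq (M : Matrix (Fin n) (Fin n) ℂ) :
    ‖M‖ ^ 2 = ∑ i, ∑ j, ‖M i j‖ ^ 2 := by
  rw [Matrix.frobenius_norm_def, ← Real.rpow_natCast, ← Real.rpow_mul (by positivity)]
  norm_num

theorem ofReal_frobenius_norm_sq (M : Matrix (Fin n) (Fin n) ℂ) :
    ((‖M‖ ^ 2 : ℝ) : ℂ) = (Mᴴ * M).trace := by
  rw [frobenius_norm_sq, Finset.sum_comm]
  simp [Matrix.trace, Matrix.mul_apply, ← Complex.conj_mul']

theorem frobenius_norm_unitary_mul {U : Matrix (Fin n) (Fin n) ℂ}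
    (hU : U ∈ Matrix.unitaryGroup (Fin n) ℂ) (M : Matrix (Fin n) (Fin n) ℂ) :
    ‖U * M‖ ^ 2 = ‖M‖ ^ 2 := by
  have h : Uᴴ * U = 1 := Matrix.mem_unitaryGroup_iff'.1 hU
  have : ((‖U * M‖ ^ 2 : ℝ) : ℂ) = ((‖M‖ ^ 2 : ℝ) : ℂ) := by
    rw [ofReal_frobenius_norm_sq, ofReal_frobenius_norm_sq, Matrix.conjTranspose_mul,
      Matrix.mul_assoc, ← Matrix.mul_assoc Uᴴ, h, Matrix.one_mul]
  exact_mod_cast this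

end MatrixCalculus

/-! ### Global existence for Lipschitz equations that fix the origin. -/

section LinearODE

variable {E : Type*} [NormedAddCommGroup E] [NormedSpace ℝ E]

/-- The derivative within the union is checked on each piece. A point outside one of the closed
pieces imposes no condition there, and at `b` both pieces have the same derivative. -/
theorem hasDerivWithinAt_Icc_ite {a b c : ℝ} (hab : a ≤ b) (hbc : b ≤ c) {α β γ' : ℝ → E}
    (hα : ∀ t ∈ Icc a b, HasDerivWithinAt α (γ' t) (Icc a b) t)
    (hβ : ∀ t ∈ Icc b c, HasDerivWithinAt β (γ' t) (Icc b c) t) (heq : α b = β b) :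
    ∀ t ∈ Icc a c,
      HasDerivWithinAt (fun t => if t ≤ b then α t else β t) (γ' t) (Icc a c) t := by
  intro t ht
  rw [← Icc_union_Icc_eq_Icc hab hbc]
  refine HasDerivWithinAt.union ?_ ?_
  · by_cases h : t ≤ b
    · exact (hα t ⟨ht.1, h⟩).congr (fun x hx => if_pos hx.2) (if_pos h)
    · refine HasFDerivWithinAt.of_notMem_closure ?_
      rw [isClosed_Icc.closure_eq]
      exact fun h' => h h'.2
  · have hval : ∀ x ∈ Icc b c, (if x ≤ b then α x else β x) = β x := by
      intro x hx
      split_ifs with h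
      · rw [le_antisymm h hx.1, heq]
      · rfl
    by_cases h : b ≤ t
    · exact (hβ t ⟨h, ht.2⟩).congr hval (hval t ⟨h, ht.2⟩)
    · refine HasFDerivWithinAt.of_notMem_closure ?_
      rw [isClosed_Icc.closure_eq]
      exact fun h' => h h'.1

variable [CompleteSpace E]

open scoped NNReal in
/-- Short-time existence, with a step that does not depend on the initial value. -/
theorem exists_hasDerivWithinAt_Icc_of_lipschitzWith_of_le {f : ℝ → E → E} {K : ℝ≥0} {a b : ℝ}
    (hab : a ≤ b) (hstep : (K + 1) * (b - a) ≤ 1 / 2)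
    (hlip : ∀ t ∈ Icc a b, LipschitzWith K (f t)) (hzero : ∀ t, f t 0 = 0)
    (hcont : ∀ x, ContinuousOn (f · x) (Icc a b)) (x₀ : E) :
    ∃ α : ℝ → E, α a = x₀ ∧ ∀ t ∈ Icc a b, HasDerivWithinAt α (f t (α t)) (Icc a b) t := by
  -- On the ball of radius ‖x₀‖ about x₀ points have norm at most 2‖x₀‖, so the field is bounded by
  -- 2K‖x₀‖. A time step with K(b - a) ≤ 1/2 stays in the ball, whatever x₀ is.
  have hpl : IsPicardLindelof f (⟨a, left_mem_Icc.2 hab⟩ : Icc a b) x₀ ‖x₀‖₊ 0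
      (K * (2 * ‖x₀‖₊)) K :=
    { lipschitzOnWith := fun t ht => (hlip t ht).lipschitzOnWith
      continuousOn := fun x _ => hcont x
      norm_le := by
        intro t ht x hx
        have h1 := (hlip t ht).dist_le_mul x 0
        rw [hzero, dist_zero_right, dist_zero_right] at h1
        refine h1.trans ?_
        push_cast
        gcongr
        have := norm_le_norm_add_norm_sub' x x₀
        rw [mem_closedBall_iff_norm] at hx
        simp only [coe_nnnorm] at hx
        linarith
      mul_max_le := by
        have h0 : (0 : ℝ) ≤ b - a := sub_nonneg.2 hab
        simp only [sub_self, max_eq_left h0]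
        push_cast
        have hx : 0 ≤ ‖x₀‖ := norm_nonneg _
        have : K * (b - a) ≤ 1 / 2 := by nlinarith
        nlinarith }
  exact hpl.exists_eq_forall_mem_Icc_hasDerivWithinAt₀

open scoped NNReal in
-- The admissible step h = 1/(2(K + 1)) is the same for every initial value, so finitely many short
-- solutions, each started where the last one ends, are glued to cover the interval.
theorem exists_hasDerivWithinAt_Icc_of_lipschitzWith {f : ℝ → E → E} {K : ℝ≥0} {a b : ℝ}
    (hab : a ≤ b) (hlip : ∀ t ∈ Icc a b, LipschitzWith K (f t)) (hzero : ∀ t, f t 0 = 0)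
    (hcont : ∀ x, ContinuousOn (f · x) (Icc a b)) (x₀ : E) :
    ∃ α : ℝ → E, α a = x₀ ∧ ∀ t ∈ Icc a b, HasDerivWithinAt α (f t (α t)) (Icc a b) t := by
  set h : ℝ := 1 / (2 * (K + 1)) with hh
  have hKpos : (0 : ℝ) < K + 1 := by positivity
  have hpos : 0 < h := by positivity
  have key : ∀ m : ℕ, ∀ c ∈ Icc a b, c ≤ a + m * h →
      ∃ α : ℝ → E, α a = x₀ ∧ ∀ t ∈ Icc a c, HasDerivWithinAt α (f t (α t)) (Icc a c) t := by
    intro m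
    induction m with
    | zero =>
      intro c hc hle
      refine exists_hasDerivWithinAt_Icc_of_lipschitzWith_of_le (K := K) hc.1 ?_
        (fun t ht => hlip t ⟨ht.1, ht.2.trans hc.2⟩) hzero
        (fun x => (hcont x).mono (Icc_subset_Icc_right hc.2)) x₀
      have : c - a ≤ 0 := by simpa using hle
      nlinarith
    | succ m ih =>
      intro c hc hle
      by_cases hcm : c ≤ a + m * h
      · exact ih c hc hcm
      push Not at hcm
      have hb' : a + m * h ∈ Icc a b := ⟨by linarith [show 0 ≤ m * h by positivity],
        hcm.le.trans hc.2⟩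
      obtain ⟨α, hα0, hα⟩ := ih _ hb' le_rfl
      have hstep : (K + 1) * (c - (a + m * h)) ≤ 1 / 2 := by
        have h1 : c - (a + m * h) ≤ h := by push_cast at hle; linarith
        calc (K + 1 : ℝ) * (c - (a + m * h)) ≤ (K + 1) * h := by gcongr
          _ = 1 / 2 := by rw [hh]; field_simp
      obtain ⟨β, hβ0, hβ⟩ := exists_hasDerivWithinAt_Icc_of_lipschitzWith_of_le hcm.le hstep
        (fun t ht => hlip t ⟨hb'.1.trans ht.1, ht.2.trans hc.2⟩) hzero
        (fun x => (hcont x).mono (Icc_subset_Icc hb'.1 hc.2)) (α (a + m * h))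
      refine ⟨fun t => if t ≤ a + m * h then α t else β t, by simp [hb'.1, hα0], ?_⟩
      have glue := hasDerivWithinAt_Icc_ite hb'.1 hcm.le
        (γ' := fun t => f t (if t ≤ a + m * h then α t else β t)) (α := α) (β := β) ?_ ?_ hβ0.symm
      · exact glue
      · intro t ht
        simpa only [if_pos ht.2] using hα t ht
      · intro t ht
        have : (if t ≤ a + m * h then α t else β t) = β t := by
          split_ifs with h
          · rw [le_antisymm h ht.1, hβ0]
          · rfl
        simpa only [this] using hβ t ht
  obtain ⟨m, hm⟩ := exists_nat_ge ((b - a) / h)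
  refine key m b (right_mem_Icc.2 hab) ?_
  rw [div_le_iff₀ hpos] at hm
  linarith

end LinearODE

/-! ### Linear matrix equations on the unit interval. -/

section MatrixODE

variable {n : ℕ}

theorem exists_forall_frobenius_norm_le {G : ℝ → Matrix (Fin n) (Fin n) ℂ}
    (hG : ContinuousOn G (Icc 0 1)) : ∃ C : ℝ, 0 ≤ C ∧ ∀ t ∈ Icc (0 : ℝ) 1, ‖G t‖ ≤ C := by
  obtain ⟨C, hC⟩ := isCompact_Icc.exists_bound_of_continuousOn hG
  exact ⟨max C 0, le_max_right _ _, fun t ht => (hC t ht).trans (le_max_left _ _)⟩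

/-- Global existence for the linear system `V' = G V` on `[0,1]`. -/
theorem exists_linear_ode_solution {G : ℝ → Matrix (Fin n) (Fin n) ℂ}
    (hG : ContinuousOn G (Icc 0 1)) (V₀ : Matrix (Fin n) (Fin n) ℂ) :
    ∃ V : ℝ → Matrix (Fin n) (Fin n) ℂ, V 0 = V₀ ∧
      ∀ t ∈ Icc (0 : ℝ) 1, HasDerivWithinAt V (G t * V t) (Icc 0 1) t := by
  obtain ⟨C, hC0, hC⟩ := exists_forall_frobenius_norm_le hG
  have : CompleteSpace (Matrix (Fin n) (Fin n) ℂ) := FiniteDimensional.complete ℝ _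
  refine exists_hasDerivWithinAt_Icc_of_lipschitzWith (f := fun t V => G t * V)
    (K := ⟨C, hC0⟩) zero_le_one ?_ (by simp) ?_ V₀
  · intro t ht
    refine LipschitzWith.of_dist_le_mul fun x y => ?_
    rw [dist_eq_norm, dist_eq_norm, ← Matrix.mul_sub]
    refine (Matrix.frobenius_norm_mul _ _).trans ?_
    gcongr
    exact hC t ht
  · intro x
    refine (contDiffOn_zero (𝕜 := ℝ)).1 ?_
    exact (contDiffOn_zero.2 hG).matrix_mul contDiffOn_const

/-- A solution of `W' = G W` that vanishes at `0` vanishes on `[0,1]`. -/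
theorem eq_zero_of_linear_ode {G W : ℝ → Matrix (Fin n) (Fin n) ℂ}
    (hG : ContinuousOn G (Icc 0 1))
    (hW : ∀ t ∈ Icc (0 : ℝ) 1, HasDerivWithinAt W (G t * W t) (Icc 0 1) t) (h0 : W 0 = 0) :
    ∀ t ∈ Icc (0 : ℝ) 1, W t = 0 := by
  obtain ⟨C, hC0, hC⟩ := exists_forall_frobenius_norm_le hG
  refine eq_zero_of_abs_deriv_le_mul_abs_self_of_eq_zero_right (K := C)
    (f' := fun t => G t * W t) (fun t ht => (hW t ht).continuousWithinAt) ?_ h0 ?_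
  · intro t ht
    refine (hW t ⟨ht.1, ht.2.le⟩).mono_of_mem_nhdsWithin ?_
    exact Filter.mem_of_superset (Icc_mem_nhdsGE ht.2) (Icc_subset_Icc_left ht.1)
  · intro t ht
    refine (Matrix.frobenius_norm_mul _ _).trans ?_
    gcongr
    exact hC t ⟨ht.1, ht.2.le⟩

theorem contDiffOn_Icc_succ_iff {E : Type*} [NormedAddCommGroup E] [NormedSpace ℝ E] {m : ℕ∞}
    {f : ℝ → E} : ContDiffOn ℝ ((m + 1 : ℕ∞) : WithTop ℕ∞) f (Icc 0 1) ↔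
      DifferentiableOn ℝ f (Icc 0 1) ∧ ContDiffOn ℝ m (derivWithin f (Icc 0 1)) (Icc 0 1) := by
  push_cast
  rw [contDiffOn_succ_iff_derivWithin (uniqueDiffOn_Icc zero_lt_one)]
  simp

/-- Bootstrapping: if V is C^j with j ≤ m, then V' = GV is C^j and V is C^{j+1}. Reduction to finite
orders covers m = ∞. -/
theorem contDiffOn_of_linear_ode {m : ℕ∞} {G V : ℝ → Matrix (Fin n) (Fin n) ℂ}
    (hG : ContDiffOn ℝ m G (Icc 0 1))
    (hV : ∀ t ∈ Icc (0 : ℝ) 1, HasDerivWithinAt V (G t * V t) (Icc 0 1) t) :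
    ContDiffOn ℝ ((m + 1 : ℕ∞) : WithTop ℕ∞) V (Icc 0 1) := by
  rw [contDiffOn_iff_forall_nat_le]
  intro j
  induction j with
  | zero =>
    intro _
    exact contDiffOn_zero.2 fun t ht => (hV t ht).continuousWithinAt
  | succ j ih =>
    intro hj
    have hjm : (j : ℕ∞) ≤ m := by
      push_cast at hj
      exact (ENat.add_le_add_iff_right ENat.one_ne_top).1 hj
    have hVj := ih (hjm.trans le_self_add)
    have := (contDiffOn_Icc_succ_iff (m := j) (f := V)).2
      ⟨fun t ht => (hV t ht).differentiableWithinAt, ?_⟩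
    · exact_mod_cast this
    · refine ContDiffOn.congr (f := fun t => G t * V t)
        ((hG.of_le (by exact_mod_cast hjm)).matrix_mul hVj) ?_
      intro t ht
      exact (hV t ht).derivWithin (uniqueDiffOn_Icc zero_lt_one t ht)

end MatrixODE

/-! ### Singular values as the sorted spectrum of A*A. -/

section SingularValues

variable {n : ℕ}

theorem eq_of_antitone_of_map_univ_eq {f g : Fin n → ℝ} (hf : Antitone f) (hg : Antitone g)
    (h : Multiset.map f Finset.univ.val = Multiset.map g Finset.univ.val) : f = g := by
  have hperm : (List.ofFn f).Perm (List.ofFn g) := by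
    rw [← Multiset.coe_eq_coe]
    simpa [Fin.univ_val_map] using h
  exact List.ofFn_injective (hperm.eq_of_pairwise' (r := (· ≥ ·))
    (List.pairwise_ofFn.2 fun _ _ hij => hf hij.le) (List.pairwise_ofFn.2 fun _ _ hij => hg hij.le))

theorem unitary_conjTranspose_mul {U : Matrix (Fin n) (Fin n) ℂ}
    (hU : U ∈ Matrix.unitaryGroup (Fin n) ℂ) : Uᴴ * U = 1 :=
  Matrix.mem_unitaryGroup_iff'.1 hU

theorem unitary_mul_conjTranspose {U : Matrix (Fin n) (Fin n) ℂ}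
    (hU : U ∈ Matrix.unitaryGroup (Fin n) ℂ) : U * Uᴴ = 1 :=
  Matrix.mem_unitaryGroup_iff.1 hU

theorem charpoly_unitary_conj_diagonal {V : Matrix (Fin n) (Fin n) ℂ}
    (hV : V ∈ Matrix.unitaryGroup (Fin n) ℂ) (d : Fin n → ℂ) :
    (V * Matrix.diagonal d * Vᴴ).charpoly = ∏ j, (Polynomial.X - Polynomial.C (d j)) := by
  rw [Matrix.charpoly_mul_comm, ← Matrix.mul_assoc, unitary_conjTranspose_mul hV, Matrix.one_mul,
    Matrix.charpoly_diagonal]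

/-- The roots of the characteristic polynomial recover the diagonal entries as a multiset, and the
ordering recovers the function. -/
theorem eq_of_antitone_of_unitary_conj_diagonal_eq {V W : Matrix (Fin n) (Fin n) ℂ}
    (hV : V ∈ Matrix.unitaryGroup (Fin n) ℂ) (hW : W ∈ Matrix.unitaryGroup (Fin n) ℂ)
    {f g : Fin n → ℝ} (hf : Antitone f) (hg : Antitone g)
    (h : V * Matrix.diagonal (fun j => (f j : ℂ)) * Vᴴ = W * Matrix.diagonal (fun j => (g j : ℂ)) * Wᴴ) :
    f = g := by
  have h1 := congrArg (fun M => M.charpoly.roots) h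
  simp only [charpoly_unitary_conj_diagonal hV, charpoly_unitary_conj_diagonal hW,
    Finset.prod_eq_multiset_prod] at h1
  have hroots : ∀ d : Fin n → ℝ, (Multiset.map (fun j => Polynomial.X - Polynomial.C (d j : ℂ))
      Finset.univ.val).prod.roots = Multiset.map (fun j => (d j : ℂ)) Finset.univ.val := by
    intro d
    rw [← Polynomial.roots_multiset_prod_X_sub_C (Multiset.map (fun j => (d j : ℂ)) _),
      Multiset.map_map]
    rfl
  rw [hroots, hroots] at h1
  refine eq_of_antitone_of_map_univ_eq hf hg ?_
  have h2 := congrArg (Multiset.map Complex.re) h1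
  simpa [Multiset.map_map, Function.comp_def] using h2

theorem singularValue_antitone (A : Matrix (Fin n) (Fin n) ℂ) : Antitone (singularValue A) :=
  fun _ _ hij => (Matrix.toEuclideanLin A).singularValues_antitone hij

theorem singularValue_nonneg (A : Matrix (Fin n) (Fin n) ℂ) (j : Fin n) :
    0 ≤ singularValue A j :=
  (Matrix.toEuclideanLin A).singularValues_nonneg j

/-- The columns of V are orthonormal eigenvectors of T*T, indexed by its sorted eigenvalues, which
are the squared singular values in their own order. -/
theorem exists_unitary_conjTranspose_mul_self_eq (A : Matrix (Fin n) (Fin n) ℂ) :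
    ∃ V ∈ Matrix.unitaryGroup (Fin n) ℂ,
      Aᴴ * A = V * Matrix.diagonal (fun j => ((singularValue A j ^ 2 : ℝ) : ℂ)) * Vᴴ := by
  set T := Matrix.toEuclideanLin A with hT
  have hn : Module.finrank ℂ (EuclideanSpace ℂ (Fin n)) = n := finrank_euclideanSpace_fin
  set b := T.isSymmetric_adjoint_comp_self.eigenvectorBasis hn with hb
  set V : Matrix (Fin n) (Fin n) ℂ :=
    (EuclideanSpace.basisFun (Fin n) ℂ).toBasis.toMatrix b.toBasis with hVdef
  have hVapp : ∀ i j, V i j = b j i := by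
    intro i j
    simp [hVdef, Module.Basis.toMatrix_apply]
  have hV : V ∈ Matrix.unitaryGroup (Fin n) ℂ := by
    rw [hVdef, OrthonormalBasis.coe_toBasis]
    exact (EuclideanSpace.basisFun (Fin n) ℂ).toMatrix_orthonormalBasis_mem_unitary b
  refine ⟨V, hV, ?_⟩
  have hmul : Aᴴ * A * V = V * Matrix.diagonal (fun j => ((singularValue A j ^ 2 : ℝ) : ℂ)) := by
    ext i j
    have h1 := T.isSymmetric_adjoint_comp_self.apply_eigenvectorBasis hn j
    rw [← hb, ← T.sq_singularValues_fin hn j, LinearMap.comp_apply, hT,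
      ← Matrix.toEuclideanLin_conjTranspose_eq_adjoint] at h1
    have h2 := congrArg (fun v : EuclideanSpace ℂ (Fin n) => v i) h1
    rw [Matrix.mul_diagonal, hVapp, Matrix.mul_apply]
    simp only [hVapp]
    simpa [Matrix.toLpLin_apply, Matrix.mulVec, dotProduct, singularValue, mul_comm] using h2
  rw [← hmul, Matrix.mul_assoc, unitary_mul_conjTranspose hV, Matrix.mul_one]

theorem sigmaMatrix_conjTranspose (σ : Fin n → ℝ) : (sigmaMatrix σ)ᴴ = sigmaMatrix σ := by
  simp [sigmaMatrix, Matrix.diagonal_conjTranspose, Pi.star_def]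

theorem sigmaMatrix_mul_self (σ : Fin n → ℝ) :
    sigmaMatrix σ * sigmaMatrix σ = Matrix.diagonal (fun j => ((σ j ^ 2 : ℝ) : ℂ)) := by
  simp [sigmaMatrix, sq]

theorem IsSVD.conjTranspose_mul_self {A U V : Matrix (Fin n) (Fin n) ℂ} {σ : Fin n → ℝ}
    (h : IsSVD A U σ V) : Aᴴ * A = V * Matrix.diagonal (fun j => ((σ j ^ 2 : ℝ) : ℂ)) * Vᴴ := by
  rw [h.eq, ← sigmaMatrix_mul_self]
  simp only [Matrix.conjTranspose_mul, Matrix.conjTranspose_conjTranspose,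
    sigmaMatrix_conjTranspose, Matrix.mul_assoc]
  rw [← Matrix.mul_assoc Uᴴ, unitary_conjTranspose_mul h.unitary_left, Matrix.one_mul]

/-- The diagonal factor of a singular value decomposition is determined by the matrix. -/
theorem IsSVD.eq_singularValue {A U V : Matrix (Fin n) (Fin n) ℂ} {σ : Fin n → ℝ}
    (h : IsSVD A U σ V) : σ = singularValue A := by
  obtain ⟨W, hW, hWA⟩ := exists_unitary_conjTranspose_mul_self_eq A
  have hsq : (fun j => σ j ^ 2) = fun j => singularValue A j ^ 2 :=
    eq_of_antitone_of_unitary_conj_diagonal_eq h.unitary_right hW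
      (fun i j hij => pow_le_pow_left₀ (h.nonneg j) (h.antitone hij) 2)
      (fun i j hij => pow_le_pow_left₀ (singularValue_nonneg A j) (singularValue_antitone A hij) 2)
      (h.conjTranspose_mul_self.symm.trans hWA)
  funext j
  exact (pow_left_inj₀ (h.nonneg j) (singularValue_nonneg A j) two_ne_zero).1 (congrFun hsq j)

end SingularValues

/-! ### Regularity of simple eigenvalues. -/

section SmoothEigenvalues

variable {n : ℕ}

open scoped Topology ContDiff

theorem contDiff_matrix_apply {m : WithTop ℕ∞} (i j : Fin n) :
    ContDiff ℝ m (fun B : Matrix (Fin n) (Fin n) ℂ => B i j) :=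
  contDiffOn_univ.1 (contDiffOn_matrix_iff.1 contDiffOn_id i j)

theorem ContDiffOn.matrix_det {m : WithTop ℕ∞} {E : Type*} [NormedAddCommGroup E]
    [NormedSpace ℝ E] {s : Set E} {M : E → Matrix (Fin n) (Fin n) ℂ}
    (hM : ContDiffOn ℝ m M s) : ContDiffOn ℝ m (fun x => (M x).det) s := by
  simp only [Matrix.det_apply]
  rw [contDiffOn_matrix_iff] at hM
  exact ContDiffOn.sum fun σ _ => (contDiffOn_prod fun i _ => hM _ _).const_smul _

theorem det_sub_unitary_conj_diagonal {V : Matrix (Fin n) (Fin n) ℂ}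
    (hV : V ∈ Matrix.unitaryGroup (Fin n) ℂ) (d : Fin n → ℝ) (x : ℝ) :
    (Matrix.diagonal (fun _ : Fin n => (x : ℂ)) - V * Matrix.diagonal (fun j => (d j : ℂ)) * Vᴴ).det =
      ((∏ j, (x - d j) : ℝ) : ℂ) := by
  have h := congrArg (Polynomial.eval (x : ℂ))
    (charpoly_unitary_conj_diagonal hV (fun j => (d j : ℂ)))
  rw [Matrix.eval_charpoly, Polynomial.eval_prod] at h
  simpa using h

/-- Near a Hermitian matrix with simple eigenvalues, each eigenvalue extends to a smooth root of
the real part of the characteristic polynomial. -/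
theorem exists_contDiffAt_root {V : Matrix (Fin n) (Fin n) ℂ}
    (hV : V ∈ Matrix.unitaryGroup (Fin n) ℂ) {d : Fin n → ℝ} (hd : Function.Injective d)
    (j : Fin n) {B₀ : Matrix (Fin n) (Fin n) ℂ}
    (hB₀ : B₀ = V * Matrix.diagonal (fun j => (d j : ℂ)) * Vᴴ) :
    ∃ g : Matrix (Fin n) (Fin n) ℂ → ℝ, ContDiffAt ℝ ∞ g B₀ ∧ g B₀ = d j ∧
      ∀ᶠ B in 𝓝 B₀, (Matrix.diagonal (fun _ : Fin n => (g B : ℂ)) - B).det.re = 0 := by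
  have : CompleteSpace (Matrix (Fin n) (Fin n) ℂ) := FiniteDimensional.complete ℝ _
  -- Matrices near B₀ need not be Hermitian, so the determinant may be complex. Its real part gives
  -- one real equation for the one real unknown, and loses nothing on Hermitian matrices.
  set Φ : Matrix (Fin n) (Fin n) ℂ × ℝ → ℝ :=
    fun p => (Matrix.diagonal (fun _ : Fin n => (p.2 : ℂ)) - p.1).det.re with hΦ
  have hΦd : ContDiff ℝ ∞ Φ := by
    rw [← contDiffOn_univ]
    refine Complex.reCLM.contDiff.comp_contDiffOn (ContDiffOn.matrix_det ?_)
    rw [contDiffOn_matrix_iff]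
    intro i l
    refine ContDiffOn.sub ?_ ((contDiff_matrix_apply i l).comp contDiff_fst).contDiffOn
    by_cases h : i = l
    · subst h
      simpa [Function.comp_def] using (Complex.ofRealCLM.contDiff.comp contDiff_snd).contDiffOn
    · simpa [Matrix.diagonal_apply_ne _ h] using contDiffOn_const
  have hΦline : ∀ x : ℝ, Φ (B₀, x) = ∏ l, (x - d l) := by
    intro x
    rw [hΦ, hB₀]
    simp only [det_sub_unitary_conj_diagonal hV, Complex.ofReal_re]
  set u : Matrix (Fin n) (Fin n) ℂ × ℝ := (B₀, d j) with hu
  have hfd : HasFDerivAt Φ (fderiv ℝ Φ u) u :=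
    (hΦd.differentiable (by simp)).differentiableAt.hasFDerivAt
  -- c is the derivative of ∏ (x - d l) at x = d j: only the term that differentiates the factor x -
  -- d j survives. Simplicity gives c ≠ 0, the invertibility needed for the implicit function.
  set c : ℝ := ∏ l ∈ Finset.univ.erase j, (d j - d l) with hc
  have hc0 : c ≠ 0 := by
    refine Finset.prod_ne_zero_iff.2 fun l hl => sub_ne_zero.2 fun h => ?_
    exact (Finset.mem_erase.1 hl).1 (hd h).symm
  have hval : fderiv ℝ Φ u (0, 1) = c := by
    have h1 : HasDerivAt (fun x : ℝ => Φ (B₀, x)) (fderiv ℝ Φ u (0, 1)) (d j) :=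
      hfd.comp_hasDerivAt (d j) ((hasDerivAt_const _ _).prodMk (hasDerivAt_id _))
    have h2 : HasDerivAt (fun x : ℝ => Φ (B₀, x)) c (d j) := by
      have : (fun x : ℝ => Φ (B₀, x)) =
          fun x => (x - d j) * ∏ l ∈ Finset.univ.erase j, (x - d l) := by
        funext x
        rw [hΦline, Finset.mul_prod_erase _ (fun l => x - d l) (Finset.mem_univ j)]
      rw [this]
      have hdiff : DifferentiableAt ℝ
          (fun x : ℝ => ∏ l ∈ Finset.univ.erase j, (x - d l)) (d j) := by
        fun_prop
      have h3 := ((hasDerivAt_id (d j)).sub_const (d j)).mul hdiff.hasDerivAt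
      simpa [Pi.mul_def] using h3
    exact h1.unique h2
  have hinv : (fderiv ℝ Φ u ∘L .inr ℝ (Matrix (Fin n) (Fin n) ℂ) ℝ).IsInvertible := by
    refine ⟨ContinuousLinearEquiv.unitsEquivAut ℝ (Units.mk0 c hc0), ?_⟩
    ext
    simp [hval]
  have hcd : ContDiffAt ℝ ∞ Φ u := hΦd.contDiffAt
  have hne : (∞ : WithTop ℕ∞) ≠ 0 := by simp
  refine ⟨hcd.implicitFunction hne hinv, hcd.contDiffAt_implicitFunction hne hinv,
    hcd.implicitFunction_apply_self hne hinv, ?_⟩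
  have hzero : Φ u = 0 := by
    rw [hu, hΦline]
    exact Finset.prod_eq_zero (Finset.mem_univ j) (sub_self _)
  filter_upwards [hcd.eventually_apply_implicitFunction hne hinv] with B hB
  rw [hzero] at hB
  exact hB

/-- The matching of indices is a strictly increasing self-map of `Fin n`, hence the identity. -/
theorem eq_of_strictAnti_of_forall_exists_eq {f g : Fin n → ℝ} (hf : StrictAnti f)
    (hg : StrictAnti g) (h : ∀ l, ∃ i, f l = g i) : f = g := by
  choose φ hφ using h
  have hmono : StrictMono φ := by
    intro a b hab
    have := hf hab
    rw [hφ a, hφ b] at this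
    exact hg.lt_iff_gt.1 this
  have hid : φ = id := by
    refine (hmono.range_inj strictMono_id).1 ?_
    rw [Set.range_id, (Finite.surjective_of_injective hmono.injective).range_eq]
  funext l
  rw [hφ, hid, id]

/-- The decreasing eigenvalues of a `C^m` path of Hermitian matrices with simple eigenvalues are
`C^m`. -/
theorem contDiffOn_eigenvalue {m : ℕ∞} {s : Set ℝ} {B : ℝ → Matrix (Fin n) (Fin n) ℂ}
    (hB : ContDiffOn ℝ m B s) {V : ℝ → Matrix (Fin n) (Fin n) ℂ}
    (hV : ∀ t ∈ s, V t ∈ Matrix.unitaryGroup (Fin n) ℂ) {d : ℝ → Fin n → ℝ}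
    (hd : ∀ t ∈ s, StrictAnti (d t))
    (hBV : ∀ t ∈ s, B t = V t * Matrix.diagonal (fun j => (d t j : ℂ)) * (V t)ᴴ) :
    ContDiffOn ℝ m d s := by
  intro t₀ ht₀
  choose g hg hg0 hgroot using fun j =>
    exists_contDiffAt_root (hV t₀ ht₀) (hd t₀ ht₀).injective j (hBV t₀ ht₀)
  have hcd : ∀ j, ContDiffWithinAt ℝ m (fun t => g j (B t)) s t₀ := fun j =>
    ((hg j).of_le (by exact_mod_cast le_top)).comp_contDiffWithinAt t₀ (hB t₀ ht₀)
  have hBc : Filter.Tendsto B (𝓝[s] t₀) (𝓝 (B t₀)) := (hB t₀ ht₀).continuousWithinAt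
  have hev1 : ∀ᶠ t in 𝓝[s] t₀, ∀ j, (Matrix.diagonal (fun _ : Fin n => (g j (B t) : ℂ)) - B t).det.re = 0 :=
    Filter.eventually_all.2 fun j => hBc.eventually (hgroot j)
  have hev2 : ∀ᶠ t in 𝓝[s] t₀, ∀ i j, i < j → g j (B t) < g i (B t) := by
    refine Filter.eventually_all.2 fun i => Filter.eventually_all.2 fun j => ?_
    by_cases hij : i < j
    · have := (hcd j).continuousWithinAt.eventually_lt (hcd i).continuousWithinAt
        (by simpa only [hg0] using hd t₀ ht₀ hij)
      filter_upwards [this] with t ht _ using ht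
    · exact Filter.Eventually.of_forall fun t h => absurd h hij
  -- Near t₀ the n implicit roots are still strictly decreasing, and each one is an eigenvalue of `B
  -- t`. They are therefore all the eigenvalues, in order.
  have hev : ∀ᶠ t in 𝓝[s] t₀, d t = fun j => g j (B t) := by
    filter_upwards [hev1, hev2, self_mem_nhdsWithin] with t h1 h2 hts
    refine (eq_of_strictAnti_of_forall_exists_eq (fun i j hij => h2 i j hij) (hd t hts) ?_).symm
    intro l
    have h3 := det_sub_unitary_conj_diagonal (hV t hts) (d t) (g l (B t))
    rw [← hBV t hts] at h3
    have h4 := h1 l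
    rw [h3, Complex.ofReal_re] at h4
    obtain ⟨i, -, hi⟩ := Finset.prod_eq_zero_iff.1 h4
    exact ⟨i, sub_eq_zero.1 hi⟩
  refine ContDiffWithinAt.congr_of_eventuallyEq (contDiffWithinAt_pi.2 hcd) hev ?_
  exact funext fun j => (hg0 j).symm

end SmoothEigenvalues

/-! ### Transport of spectral projections and smooth unitary diagonalization. -/

section ProjectionTransport

variable {n : ℕ}

theorem ContDiffOn.hasDerivWithinAt_matrix {k : WithTop ℕ∞} (hk : 1 ≤ k)
    {M : ℝ → Matrix (Fin n) (Fin n) ℂ} (hM : ContDiffOn ℝ k M (Icc 0 1)) {t : ℝ}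
    (ht : t ∈ Icc (0 : ℝ) 1) :
    HasDerivWithinAt M (derivWithin M (Icc 0 1) t) (Icc 0 1) t :=
  (hM.differentiableOn (by rintro rfl; simp at hk) t ht).hasDerivWithinAt

theorem ContDiffOn.derivWithin_matrix {m : ℕ∞} {M : ℝ → Matrix (Fin n) (Fin n) ℂ}
    (hM : ContDiffOn ℝ ((m + 1 : ℕ∞) : WithTop ℕ∞) M (Icc 0 1)) :
    ContDiffOn ℝ m (fun t => derivWithin M (Icc 0 1) t) (Icc 0 1) :=
  (contDiffOn_Icc_succ_iff.1 hM).2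

theorem HasDerivWithinAt.unique_matrix {M : ℝ → Matrix (Fin n) (Fin n) ℂ}
    {M₁ M₂ : Matrix (Fin n) (Fin n) ℂ} {t : ℝ} (ht : t ∈ Icc (0 : ℝ) 1)
    (h₁ : HasDerivWithinAt M M₁ (Icc 0 1) t) (h₂ : HasDerivWithinAt M M₂ (Icc 0 1) t) :
    M₁ = M₂ :=
  (uniqueDiffOn_Icc zero_lt_one t ht).eq_deriv _ h₁ h₂

theorem HasDerivWithinAt.matrix_sum {ι : Type*} (u : Finset ι)
    {M : ι → ℝ → Matrix (Fin n) (Fin n) ℂ} {M' : ι → Matrix (Fin n) (Fin n) ℂ} {s : Set ℝ} {t : ℝ}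
    (h : ∀ i ∈ u, HasDerivWithinAt (M i) (M' i) s t) :
    HasDerivWithinAt (fun t => ∑ i ∈ u, M i t) (∑ i ∈ u, M' i) s t :=
  HasDerivWithinAt.fun_sum h

/-- The flow of a skew-Hermitian linear system is unitary. -/
theorem unitary_of_linear_ode {G V : ℝ → Matrix (Fin n) (Fin n) ℂ}
    (hG : ∀ t ∈ Icc (0 : ℝ) 1, (G t)ᴴ + G t = 0)
    (hV : ∀ t ∈ Icc (0 : ℝ) 1, HasDerivWithinAt V (G t * V t) (Icc 0 1) t)
    (h0 : V 0 ∈ Matrix.unitaryGroup (Fin n) ℂ) {t : ℝ} (ht : t ∈ Icc (0 : ℝ) 1) :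
    V t ∈ Matrix.unitaryGroup (Fin n) ℂ := by
  rw [Matrix.mem_unitaryGroup_iff', Matrix.star_eq_conjTranspose]
  -- V*V - 1 has derivative V*(G* + G)V = 0 and starts at 0.
  have key := eq_zero_of_linear_ode (G := fun _ => 0) (W := fun t => (V t)ᴴ * V t - 1)
    continuousOn_const ?_ ?_ t ht
  · exact sub_eq_zero.1 key
  · intro t ht
    have h1 := ((hV t ht).matrix_conjTranspose.matrix_mul (hV t ht)).sub_const
      (1 : Matrix (Fin n) (Fin n) ℂ)
    have h2 : (G t * V t)ᴴ * V t + (V t)ᴴ * (G t * V t) =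
        0 * ((V t)ᴴ * V t - 1) := by
      rw [Matrix.zero_mul, Matrix.conjTranspose_mul, Matrix.mul_assoc, ← Matrix.mul_add,
        ← Matrix.add_mul, hG t ht, Matrix.zero_mul, Matrix.mul_zero]
    rw [← h2]
    exact h1
  · simp only [unitary_conjTranspose_mul h0, sub_self]

/-- A complete system of orthogonal projections of class `C^{m+1}` on `[0,1]` is carried along by
a unitary path of class `C^{m+1}`, the solution of `V' = (∑ Pₗ' Pₗ) V`. -/
theorem exists_unitary_transport {m : ℕ∞} {P : Fin n → ℝ → Matrix (Fin n) (Fin n) ℂ}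
    (hP : ∀ j, ContDiffOn ℝ ((m + 1 : ℕ∞) : WithTop ℕ∞) (P j) (Icc 0 1))
    (hherm : ∀ j, ∀ t ∈ Icc (0 : ℝ) 1, (P j t)ᴴ = P j t)
    (hidem : ∀ j, ∀ t ∈ Icc (0 : ℝ) 1, P j t * P j t = P j t)
    (horth : ∀ j l, j ≠ l → ∀ t ∈ Icc (0 : ℝ) 1, P j t * P l t = 0)
    (hsum : ∀ t ∈ Icc (0 : ℝ) 1, ∑ j, P j t = 1)
    {V₀ : Matrix (Fin n) (Fin n) ℂ} (hV₀ : V₀ ∈ Matrix.unitaryGroup (Fin n) ℂ)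
    (hPV₀ : ∀ j, P j 0 * V₀ = V₀ * Matrix.single j j 1) :
    ∃ V : ℝ → Matrix (Fin n) (Fin n) ℂ,
      ContDiffOn ℝ ((m + 1 : ℕ∞) : WithTop ℕ∞) V (Icc 0 1) ∧ V 0 = V₀ ∧
      (∀ t ∈ Icc (0 : ℝ) 1, V t ∈ Matrix.unitaryGroup (Fin n) ℂ) ∧
      ∀ j, ∀ t ∈ Icc (0 : ℝ) 1, P j t * V t = V t * Matrix.single j j 1 := by
  have hone : (1 : WithTop ℕ∞) ≤ ((m + 1 : ℕ∞) : WithTop ℕ∞) := by push_cast; exact le_add_self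
  set P' : Fin n → ℝ → Matrix (Fin n) (Fin n) ℂ :=
    fun j t => derivWithin (P j) (Icc 0 1) t with hP'def
  have hP' : ∀ j, ∀ t ∈ Icc (0 : ℝ) 1, HasDerivWithinAt (P j) (P' j t) (Icc 0 1) t :=
    fun j t ht => (hP j).hasDerivWithinAt_matrix hone ht
  have hP'herm : ∀ j, ∀ t ∈ Icc (0 : ℝ) 1, (P' j t)ᴴ = P' j t := fun j t ht =>
    HasDerivWithinAt.unique_matrix ht
      (((hP' j t ht).matrix_conjTranspose).congr (fun x hx => (hherm j x hx).symm)
        (hherm j t ht).symm) (hP' j t ht)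
  have hP'idem : ∀ j, ∀ t ∈ Icc (0 : ℝ) 1, P' j t * P j t + P j t * P' j t = P' j t :=
    fun j t ht => HasDerivWithinAt.unique_matrix ht
      (((hP' j t ht).matrix_mul (hP' j t ht)).congr (fun x hx => (hidem j x hx).symm)
        (hidem j t ht).symm) (hP' j t ht)
  have hP'orth : ∀ j l, j ≠ l → ∀ t ∈ Icc (0 : ℝ) 1, P' j t * P l t + P j t * P' l t = 0 :=
    fun j l hjl t ht => HasDerivWithinAt.unique_matrix ht
      ((hP' j t ht).matrix_mul (hP' l t ht))
      ((hasDerivWithinAt_const t (Icc 0 1) (0 : Matrix (Fin n) (Fin n) ℂ)).congr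
        (fun x hx => horth j l hjl x hx) (horth j l hjl t ht))
  have hP'sum : ∀ t ∈ Icc (0 : ℝ) 1, ∑ j, P' j t = 0 :=
    fun t ht => HasDerivWithinAt.unique_matrix ht
      (HasDerivWithinAt.matrix_sum Finset.univ fun j _ => hP' j t ht)
      ((hasDerivWithinAt_const t (Icc 0 1) (1 : Matrix (Fin n) (Fin n) ℂ)).congr
        (fun x hx => hsum x hx) (hsum t ht))
  -- Kato's generator: it is skew-Hermitian and satisfies P_j' + P_j G = G P_j, so its flow is
  -- unitary and intertwines the projections.
  set G : ℝ → Matrix (Fin n) (Fin n) ℂ := fun t => ∑ l, P' l t * P l t with hG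
  have hGd : ContDiffOn ℝ m G (Icc 0 1) :=
    ContDiffOn.sum fun l _ => (hP l).derivWithin_matrix.matrix_mul
      ((hP l).of_le (by push_cast; exact le_self_add))
  have hGskew : ∀ t ∈ Icc (0 : ℝ) 1, (G t)ᴴ + G t = 0 := by
    intro t ht
    rw [hG]
    simp only [Matrix.conjTranspose_sum, Matrix.conjTranspose_mul, ← Finset.sum_add_distrib]
    rw [← hP'sum t ht]
    refine Finset.sum_congr rfl fun l _ => ?_
    rw [hherm l t ht, hP'herm l t ht, add_comm, hP'idem l t ht]
  have hGP : ∀ j, ∀ t ∈ Icc (0 : ℝ) 1, G t * P j t = P' j t * P j t := by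
    intro j t ht
    rw [hG, Finset.sum_mul, Finset.sum_eq_single j]
    · rw [Matrix.mul_assoc, hidem j t ht]
    · intro l _ hl
      rw [Matrix.mul_assoc, horth l j hl t ht, Matrix.mul_zero]
    · simp
  have hPG : ∀ j, ∀ t ∈ Icc (0 : ℝ) 1, P' j t + P j t * G t = P' j t * P j t := by
    intro j t ht
    -- For l = j, differentiating P² = P gives P P' P = 0. For l ≠ j, writing P_l as P_l² exposes
    -- the factor P_j' P_l + P_j P_l', the derivative of P_j P_l = 0.
    have hterm : ∀ l, P' j t * P l t + P j t * (P' l t * P l t) =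
        if l = j then P' j t * P j t else 0 := by
      intro l
      by_cases h : l = j
      · subst h
        rw [if_pos rfl]
        have h := congrArg (· * P l t) (hP'idem l t ht)
        simpa only [Matrix.add_mul, Matrix.mul_assoc, hidem l t ht] using h
      · rw [if_neg h]
        nth_rw 1 [← hidem l t ht]
        rw [← Matrix.mul_assoc, ← Matrix.mul_assoc, ← Matrix.add_mul,
          hP'orth j l (Ne.symm h) t ht, Matrix.zero_mul]
    calc P' j t + P j t * G t = P' j t * (∑ l, P l t) + P j t * G t := by
          rw [hsum t ht, Matrix.mul_one]
      _ = ∑ l, (P' j t * P l t + P j t * (P' l t * P l t)) := by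
          rw [hG, Finset.mul_sum, Finset.mul_sum, Finset.sum_add_distrib]
      _ = P' j t * P j t := by
          simp only [hterm, Finset.sum_ite_eq', Finset.mem_univ, if_true]
  have hGc : ContinuousOn G (Icc 0 1) := hGd.continuousOn
  obtain ⟨V, hV0, hV⟩ := exists_linear_ode_solution hGc V₀
  refine ⟨V, contDiffOn_of_linear_ode hGd hV, hV0, ?_, ?_⟩
  · exact fun t ht => unitary_of_linear_ode hGskew hV (hV0 ▸ hV₀) ht
  · intro j t ht
    -- The defect W = P_j V - V E_jj satisfies W' = GW and vanishes at 0.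
    have key := eq_zero_of_linear_ode (G := G)
      (W := fun t => P j t * V t - V t * Matrix.single j j 1) hGc ?_ ?_ t ht
    · exact sub_eq_zero.1 key
    · intro t ht
      have h1 := ((hP' j t ht).matrix_mul (hV t ht)).sub
        ((hV t ht).matrix_mul (hasDerivWithinAt_const t (Icc 0 1)
          (Matrix.single j j 1 : Matrix (Fin n) (Fin n) ℂ)))
      have h2 : (P' j t * V t + P j t * (G t * V t)) -
          (G t * V t * Matrix.single j j 1 + V t * 0) =
          G t * (P j t * V t - V t * Matrix.single j j 1) := by
        rw [Matrix.mul_zero, add_zero, Matrix.mul_sub, ← Matrix.mul_assoc (G t) (P j t),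
          hGP j t ht, ← hPG j t ht, Matrix.add_mul, Matrix.mul_assoc (P j t), Matrix.mul_assoc (G t)]
      rw [← h2]
      exact h1
    · simp only [hV0, hPV₀ j, sub_self]

theorem adjugate_of_unitary {W : Matrix (Fin n) (Fin n) ℂ}
    (hW : W ∈ Matrix.unitaryGroup (Fin n) ℂ) : W.adjugate = W.det • Wᴴ := by
  calc W.adjugate = Wᴴ * (W * W.adjugate) := by
        rw [← Matrix.mul_assoc, unitary_conjTranspose_mul hW, Matrix.one_mul]
    _ = W.det • Wᴴ := by rw [Matrix.mul_adjugate, Matrix.mul_smul, Matrix.mul_one]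

/-- The spectral projection of a Hermitian matrix at a simple eigenvalue, by the adjugate. -/
theorem unitary_single_conj_eq_adjugate {W : Matrix (Fin n) (Fin n) ℂ}
    (hW : W ∈ Matrix.unitaryGroup (Fin n) ℂ) {d : Fin n → ℝ} (hd : Function.Injective d)
    (j : Fin n) {B : Matrix (Fin n) (Fin n) ℂ}
    (hB : B = W * Matrix.diagonal (fun j => (d j : ℂ)) * Wᴴ) :
    W * Matrix.single j j 1 * Wᴴ = (∏ l ∈ Finset.univ.erase j, ((d j : ℂ) - d l))⁻¹ •
      (Matrix.diagonal (fun _ => (d j : ℂ)) - B).adjugate := by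
  have hWs : Wᴴ ∈ Matrix.unitaryGroup (Fin n) ℂ := Unitary.star_mem hW
  have hdet : W.det * Wᴴ.det = 1 := by
    rw [← Matrix.det_mul, unitary_mul_conjTranspose hW, Matrix.det_one]
  have hc : ∏ l ∈ Finset.univ.erase j, ((d j : ℂ) - d l) ≠ 0 := by
    refine Finset.prod_ne_zero_iff.2 fun l hl => sub_ne_zero.2 fun h => ?_
    exact (Finset.mem_erase.1 hl).1 (hd (by exact_mod_cast h.symm))
  have h1 : Matrix.diagonal (fun _ => (d j : ℂ)) - B =
      W * Matrix.diagonal (fun l => (d j : ℂ) - d l) * Wᴴ := by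
    have h2 : (Matrix.diagonal (fun _ => (d j : ℂ)) : Matrix (Fin n) (Fin n) ℂ) =
        W * Matrix.diagonal (fun _ => (d j : ℂ)) * Wᴴ := by
      rw [← Matrix.smul_one_eq_diagonal, Matrix.mul_smul, Matrix.mul_one, Matrix.smul_mul,
        unitary_mul_conjTranspose hW]
    rw [h2, hB, ← Matrix.sub_mul, ← Matrix.mul_sub, Matrix.diagonal_sub]
  -- The i-th product omits only l = i, so it contains the zero factor l = j unless i = j.
  have h3 : (Matrix.diagonal (fun i => ∏ l ∈ Finset.univ.erase i, ((d j : ℂ) - d l)) :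
      Matrix (Fin n) (Fin n) ℂ) =
      (∏ l ∈ Finset.univ.erase j, ((d j : ℂ) - d l)) • Matrix.single j j 1 := by
    ext a b
    by_cases hab : a = b
    · subst hab
      by_cases haj : a = j
      · subst haj; simp
      · have : ∏ l ∈ Finset.univ.erase a, ((d j : ℂ) - d l) = 0 :=
          Finset.prod_eq_zero (Finset.mem_erase.2 ⟨Ne.symm haj, Finset.mem_univ j⟩) (sub_self _)
        simp [this, Ne.symm haj]
    · rw [Matrix.diagonal_apply_ne _ hab, Matrix.smul_apply, Matrix.single_apply,
        if_neg (fun h => hab (h.1.symm.trans h.2)), smul_zero]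
  rw [h1, Matrix.adjugate_mul_distrib, Matrix.adjugate_mul_distrib, Matrix.adjugate_diagonal, h3,
    adjugate_of_unitary hW, adjugate_of_unitary hWs, Matrix.conjTranspose_conjTranspose]
  simp only [Matrix.mul_smul, Matrix.smul_mul, smul_smul, Matrix.mul_assoc]
  rw [mul_right_comm W.det, hdet, one_mul, inv_mul_cancel₀ hc, one_smul]

theorem ContDiffOn.matrix_adjugate {m : WithTop ℕ∞} {s : Set ℝ}
    {M : ℝ → Matrix (Fin n) (Fin n) ℂ} (hM : ContDiffOn ℝ m M s) :
    ContDiffOn ℝ m (fun t => (M t).adjugate) s := by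
  rw [contDiffOn_matrix_iff]
  intro i j
  simp only [Matrix.adjugate_apply]
  refine ContDiffOn.matrix_det (contDiffOn_matrix_iff.2 fun a b => ?_)
  by_cases h : a = j
  · subst h; simpa using contDiffOn_const
  · simpa [Matrix.updateRow_ne h] using contDiffOn_matrix_iff.1 hM a b

/-- A `C^{m+1}` path of Hermitian matrices with simple eigenvalues has a `C^{m+1}` unitary
diagonalization with prescribed initial value. -/
theorem exists_contDiffOn_unitary_diagonalization {m : ℕ∞} {B : ℝ → Matrix (Fin n) (Fin n) ℂ}
    (hB : ContDiffOn ℝ ((m + 1 : ℕ∞) : WithTop ℕ∞) B (Icc 0 1))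
    {W : ℝ → Matrix (Fin n) (Fin n) ℂ}
    (hW : ∀ t ∈ Icc (0 : ℝ) 1, W t ∈ Matrix.unitaryGroup (Fin n) ℂ) {d : ℝ → Fin n → ℝ}
    (hd : ∀ t ∈ Icc (0 : ℝ) 1, StrictAnti (d t))
    (hBW : ∀ t ∈ Icc (0 : ℝ) 1,
      B t = W t * Matrix.diagonal (fun j => (d t j : ℂ)) * (W t)ᴴ)
    {V₀ : Matrix (Fin n) (Fin n) ℂ} (hV₀ : V₀ ∈ Matrix.unitaryGroup (Fin n) ℂ)
    (hBV₀ : B 0 = V₀ * Matrix.diagonal (fun j => (d 0 j : ℂ)) * V₀ᴴ) :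
    ∃ V : ℝ → Matrix (Fin n) (Fin n) ℂ,
      ContDiffOn ℝ ((m + 1 : ℕ∞) : WithTop ℕ∞) V (Icc 0 1) ∧ V 0 = V₀ ∧
      (∀ t ∈ Icc (0 : ℝ) 1, V t ∈ Matrix.unitaryGroup (Fin n) ℂ) ∧
      ∀ t ∈ Icc (0 : ℝ) 1, B t = V t * Matrix.diagonal (fun j => (d t j : ℂ)) * (V t)ᴴ := by
  have h0 : (0 : ℝ) ∈ Icc (0 : ℝ) 1 := ⟨le_rfl, zero_le_one⟩
  have hdc : ∀ j, ContDiffOn ℝ ((m + 1 : ℕ∞) : WithTop ℕ∞) (fun t => (d t j : ℂ)) (Icc 0 1) :=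
    fun j => Complex.ofRealCLM.contDiff.comp_contDiffOn
      (contDiffOn_pi.1 (contDiffOn_eigenvalue hB hW hd hBW) j)
  set P : Fin n → ℝ → Matrix (Fin n) (Fin n) ℂ :=
    fun j t => W t * Matrix.single j j 1 * (W t)ᴴ with hPdef
  have hWW : ∀ t ∈ Icc (0 : ℝ) 1, ∀ M N : Matrix (Fin n) (Fin n) ℂ,
      (W t * M * (W t)ᴴ) * (W t * N * (W t)ᴴ) = W t * (M * N) * (W t)ᴴ := by
    intro t ht M N
    simp only [Matrix.mul_assoc]
    rw [← Matrix.mul_assoc (W t)ᴴ, unitary_conjTranspose_mul (hW t ht), Matrix.one_mul]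
  have htransport := exists_unitary_transport (m := m) (P := P) ?_ ?_ ?_ ?_ ?_ hV₀ ?_
  · obtain ⟨V, hVd, hV0, hVu, hPV⟩ := htransport
    refine ⟨V, hVd, hV0, hVu, fun t ht => ?_⟩
    have hdiag : (Matrix.diagonal (fun j => (d t j : ℂ)) : Matrix (Fin n) (Fin n) ℂ) =
        ∑ j, (d t j : ℂ) • Matrix.single j j 1 := by
      rw [← Matrix.sum_single_eq_diagonal]
      simp
    have hBP : B t = ∑ j, (d t j : ℂ) • P j t := by
      rw [hBW t ht, hdiag]
      simp only [Finset.mul_sum, Finset.sum_mul, Matrix.mul_smul, Matrix.smul_mul, hPdef]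
    calc B t = B t * (V t * (V t)ᴴ) := by
          rw [unitary_mul_conjTranspose (hVu t ht), Matrix.mul_one]
      _ = V t * Matrix.diagonal (fun j => (d t j : ℂ)) * (V t)ᴴ := by
          rw [← Matrix.mul_assoc, hBP, hdiag]
          simp only [Finset.mul_sum, Finset.sum_mul, Matrix.mul_smul, Matrix.smul_mul,
            hPV _ t ht]
  · intro j
    -- `W` is a pointwise choice without regularity. The adjugate formula rewrites the projection in
    -- terms of B and d alone.
    refine ContDiffOn.congr ?_ fun t ht =>
      unitary_single_conj_eq_adjugate (hW t ht) (hd t ht).injective j (hBW t ht)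
    have hadj := ContDiffOn.matrix_adjugate
      (ContDiffOn.sub (ContDiffOn.matrix_diagonal fun _ => hdc j) hB)
    refine contDiffOn_matrix_iff.2 fun a b =>
      ContDiffOn.mul (ContDiffOn.inv ?_ ?_) (contDiffOn_matrix_iff.1 hadj a b)
    · exact contDiffOn_prod fun l _ => (hdc j).sub (hdc l)
    · intro t ht
      refine Finset.prod_ne_zero_iff.2 fun l hl => sub_ne_zero.2 fun h => ?_
      exact (Finset.mem_erase.1 hl).1 ((hd t ht).injective (by exact_mod_cast h.symm))
  · intro j t ht
    simp [hPdef, Matrix.conjTranspose_mul, Matrix.mul_assoc, Matrix.conjTranspose_single]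
  · intro j t ht
    rw [hPdef]
    simp [hWW t ht]
  · intro j l hjl t ht
    rw [hPdef]
    simp [hWW t ht, Matrix.single_mul_single_of_ne, hjl]
  · intro t ht
    rw [hPdef]
    simp only [← Finset.sum_mul, ← Finset.mul_sum]
    rw [Matrix.sum_single_one, Matrix.mul_one, unitary_mul_conjTranspose (hW t ht)]
  · intro j
    rw [hPdef]
    simp only
    -- The adjugate does not depend on the diagonalizing unitary, so `W 0` and `V₀` define the same
    -- projections.
    rw [unitary_single_conj_eq_adjugate (hW 0 h0) (hd 0 h0).injective j (hBW 0 h0),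
      ← unitary_single_conj_eq_adjugate hV₀ (hd 0 h0).injective j hBV₀, Matrix.mul_assoc,
      unitary_conjTranspose_mul hV₀, Matrix.mul_one]

end ProjectionTransport

/-! ### Smooth singular value decompositions and their differential equations. -/

section SVDPaths

variable {n : ℕ} {k m : ℕ∞} {A U V P Q : ℝ → Matrix (Fin n) (Fin n) ℂ} {σ τ : ℝ → Fin n → ℝ}
  {t : ℝ}

theorem contDiffOn_singularValue (hA : ContDiffOn ℝ k A (Icc 0 1))
    (hdistinct : ∀ t ∈ Icc (0 : ℝ) 1, StrictAnti (singularValue (A t)))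
    (hpos : ∀ t ∈ Icc (0 : ℝ) 1, ∀ j, 0 < singularValue (A t) j) :
    ContDiffOn ℝ k (fun t => singularValue (A t)) (Icc 0 1) := by
  choose W hW hWA using fun t => exists_unitary_conjTranspose_mul_self_eq (A t)
  have hsq := contDiffOn_eigenvalue (d := fun t j => singularValue (A t) j ^ 2)
    (hA.matrix_conjTranspose.matrix_mul hA) (fun t _ => hW t)
    (fun t ht i j hij => pow_lt_pow_left₀ (hdistinct t ht hij) (hpos t ht j).le two_ne_zero)
    (fun t _ => hWA t)
  refine contDiffOn_pi.2 fun j => ?_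
  refine ((contDiffOn_pi.1 hsq j).sqrt fun t ht => (pow_pos (hpos t ht j) 2).ne').congr ?_
  exact fun t ht => (Real.sqrt_sq (hpos t ht j).le).symm

theorem sigmaMatrix_mul_sigmaMatrix_inv {s : Fin n → ℝ} (hs : ∀ j, 0 < s j) :
    sigmaMatrix s * sigmaMatrix (fun j => (s j)⁻¹) = 1 := by
  rw [sigmaMatrix, sigmaMatrix, Matrix.diagonal_mul_diagonal, ← Matrix.diagonal_one]
  congr 1
  funext j
  rw [← Complex.ofReal_mul, mul_inv_cancel₀ (hs j).ne', Complex.ofReal_one]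

theorem sigmaMatrix_inv_mul_sigmaMatrix {s : Fin n → ℝ} (hs : ∀ j, 0 < s j) :
    sigmaMatrix (fun j => (s j)⁻¹) * sigmaMatrix s = 1 := by
  rw [sigmaMatrix, sigmaMatrix, Matrix.diagonal_mul_diagonal, ← Matrix.diagonal_one]
  congr 1
  funext j
  rw [← Complex.ofReal_mul, inv_mul_cancel₀ (hs j).ne', Complex.ofReal_one]

/-- Every singular value decomposition of `A 0` extends to one of class `C^{m+1}`. -/
theorem exists_isSVDPath (hA : ContDiffOn ℝ ((m + 1 : ℕ∞) : WithTop ℕ∞) A (Icc 0 1))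
    (hdistinct : ∀ t ∈ Icc (0 : ℝ) 1, StrictAnti (singularValue (A t)))
    (hpos : ∀ t ∈ Icc (0 : ℝ) 1, ∀ j, 0 < singularValue (A t) j)
    {U₀ V₀ : Matrix (Fin n) (Fin n) ℂ} {σ₀ : Fin n → ℝ} (h₀ : IsSVD (A 0) U₀ σ₀ V₀) :
    ∃ U V : ℝ → Matrix (Fin n) (Fin n) ℂ,
      IsSVDPath (m + 1) A U (fun t => singularValue (A t)) V ∧ U 0 = U₀ ∧ V 0 = V₀ := by
  have h0 : (0 : ℝ) ∈ Icc (0 : ℝ) 1 := ⟨le_rfl, zero_le_one⟩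
  have hσ := contDiffOn_singularValue hA hdistinct hpos
  choose W hW hWA using fun t => exists_unitary_conjTranspose_mul_self_eq (A t)
  have hBV₀ := h₀.conjTranspose_mul_self
  rw [h₀.eq_singularValue] at hBV₀
  obtain ⟨V, hVd, hV0, hVu, hVB⟩ := exists_contDiffOn_unitary_diagonalization
    (d := fun t j => singularValue (A t) j ^ 2)
    (hA.matrix_conjTranspose.matrix_mul hA) (fun t _ => hW t)
    (fun t ht i j hij => pow_lt_pow_left₀ (hdistinct t ht hij) (hpos t ht j).le two_ne_zero)
    (fun t _ => hWA t) h₀.unitary_right hBV₀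
  have hinv : ContDiffOn ℝ ((m + 1 : ℕ∞) : WithTop ℕ∞)
      (fun t => sigmaMatrix fun j => (singularValue (A t) j)⁻¹) (Icc 0 1) :=
    ContDiffOn.sigmaMatrix (contDiffOn_pi.2 fun j =>
      (contDiffOn_pi.1 hσ j).inv fun t ht => (hpos t ht j).ne')
  -- A = UΣV* forces U = AVΣ⁻¹, which is unitary because V*(A*A)V = Σ².
  refine ⟨fun t => A t * V t * sigmaMatrix fun j => (singularValue (A t) j)⁻¹, V,
    ⟨(hA.matrix_mul hVd).matrix_mul hinv, hσ, hVd, fun t ht => ?_⟩, ?_, hV0⟩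
  · refine ⟨?_, hVu t ht, singularValue_nonneg _, singularValue_antitone _, ?_⟩
    · rw [Matrix.mem_unitaryGroup_iff', Matrix.star_eq_conjTranspose]
      simp only [Matrix.conjTranspose_mul, sigmaMatrix_conjTranspose]
      have h1 : (V t)ᴴ * ((A t)ᴴ * A t) * V t =
          sigmaMatrix (singularValue (A t)) * sigmaMatrix (singularValue (A t)) := by
        rw [hVB t ht, sigmaMatrix_mul_self]
        simp only [Matrix.mul_assoc]
        rw [unitary_conjTranspose_mul (hVu t ht), Matrix.mul_one, ← Matrix.mul_assoc,
          unitary_conjTranspose_mul (hVu t ht), Matrix.one_mul]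
      calc _ = (sigmaMatrix fun j => (singularValue (A t) j)⁻¹) *
            ((V t)ᴴ * ((A t)ᴴ * A t) * V t) *
              sigmaMatrix fun j => (singularValue (A t) j)⁻¹ := by
            simp only [Matrix.mul_assoc]
        _ = 1 := by
            rw [h1, ← Matrix.mul_assoc, sigmaMatrix_inv_mul_sigmaMatrix (hpos t ht),
              Matrix.one_mul, sigmaMatrix_mul_sigmaMatrix_inv (hpos t ht)]
    · rw [Matrix.mul_assoc (A t * V t), sigmaMatrix_inv_mul_sigmaMatrix (hpos t ht),
        Matrix.mul_one, Matrix.mul_assoc, unitary_mul_conjTranspose (hVu t ht), Matrix.mul_one]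
  · have h1 : A 0 * V₀ = U₀ * sigmaMatrix (singularValue (A 0)) := by
      rw [← h₀.eq_singularValue]
      nth_rw 1 [h₀.eq]
      rw [Matrix.mul_assoc, unitary_conjTranspose_mul h₀.unitary_right, Matrix.mul_one]
    simp only [hV0]
    rw [h1, Matrix.mul_assoc, sigmaMatrix_mul_sigmaMatrix_inv (hpos 0 h0), Matrix.mul_one]

theorem IsSVDPath.sigma_eq (h : IsSVDPath k A U σ V) (ht : t ∈ Icc (0 : ℝ) 1) :
    σ t = singularValue (A t) :=
  (h.isSVD t ht).eq_singularValue

theorem IsSVDPath.of_le {l : ℕ∞} (h : IsSVDPath k A U σ V) (hl : l ≤ k) :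
    IsSVDPath l A U σ V :=
  ⟨h.contDiffOn_left.of_le (by exact_mod_cast hl), h.contDiffOn_sigma.of_le (by exact_mod_cast hl),
    h.contDiffOn_right.of_le (by exact_mod_cast hl), h.isSVD⟩

/-- The body-frame velocity `U* U'` of a path of matrices on `[0,1]`. -/
def bodyVelocity (U : ℝ → Matrix (Fin n) (Fin n) ℂ) (t : ℝ) : Matrix (Fin n) (Fin n) ℂ :=
  (U t)ᴴ * derivWithin U (Icc 0 1) t

theorem hasDerivWithinAt_bodyVelocity (hU : ContDiffOn ℝ ((1 : ℕ∞) : WithTop ℕ∞) U (Icc 0 1))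
    (ht : t ∈ Icc (0 : ℝ) 1) (hu : U t ∈ Matrix.unitaryGroup (Fin n) ℂ) :
    HasDerivWithinAt U (U t * bodyVelocity U t) (Icc 0 1) t := by
  rw [bodyVelocity, ← Matrix.mul_assoc, unitary_mul_conjTranspose hu, Matrix.one_mul]
  exact hU.hasDerivWithinAt_matrix le_rfl ht

theorem bodyVelocity_eq {H : Matrix (Fin n) (Fin n) ℂ} (ht : t ∈ Icc (0 : ℝ) 1)
    (hu : U t ∈ Matrix.unitaryGroup (Fin n) ℂ)
    (h : HasDerivWithinAt U (U t * H) (Icc 0 1) t) : bodyVelocity U t = H := by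
  have h1 : derivWithin U (Icc 0 1) t = U t * H :=
    h.derivWithin (uniqueDiffOn_Icc zero_lt_one t ht)
  rw [bodyVelocity, h1, ← Matrix.mul_assoc, unitary_conjTranspose_mul hu, Matrix.one_mul]

/-- Differentiate U*U = 1. -/
theorem bodyVelocity_conjTranspose (hU : ContDiffOn ℝ ((1 : ℕ∞) : WithTop ℕ∞) U (Icc 0 1))
    (hu : ∀ t ∈ Icc (0 : ℝ) 1, U t ∈ Matrix.unitaryGroup (Fin n) ℂ) (ht : t ∈ Icc (0 : ℝ) 1) :
    (bodyVelocity U t)ᴴ = -bodyVelocity U t := by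
  have h1 := hasDerivWithinAt_bodyVelocity hU ht (hu t ht)
  have h2 := HasDerivWithinAt.unique_matrix ht (h1.matrix_conjTranspose.matrix_mul h1)
    ((hasDerivWithinAt_const t (Icc 0 1) (1 : Matrix (Fin n) (Fin n) ℂ)).congr
      (fun x hx => unitary_conjTranspose_mul (hu x hx)) (unitary_conjTranspose_mul (hu t ht)))
  rw [Matrix.conjTranspose_mul, Matrix.mul_assoc, ← Matrix.mul_assoc (U t)ᴴ,
    unitary_conjTranspose_mul (hu t ht), Matrix.one_mul, Matrix.mul_one] at h2
  exact eq_neg_of_add_eq_zero_left h2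

theorem norm_derivWithin_sq (hu : U t ∈ Matrix.unitaryGroup (Fin n) ℂ) :
    ‖derivWithin U (Icc 0 1) t‖ ^ 2 = ‖bodyVelocity U t‖ ^ 2 := by
  exact (frobenius_norm_unitary_mul (Unitary.star_mem hu) _).symm

theorem IsSVDPath.skew_left (h : IsSVDPath 1 A U σ V) (ht : t ∈ Icc (0 : ℝ) 1) :
    (bodyVelocity U t)ᴴ = -bodyVelocity U t :=
  bodyVelocity_conjTranspose h.contDiffOn_left (fun t ht => (h.isSVD t ht).unitary_left) ht

theorem IsSVDPath.skew_right (h : IsSVDPath 1 A U σ V) (ht : t ∈ Icc (0 : ℝ) 1) :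
    (bodyVelocity V t)ᴴ = -bodyVelocity V t :=
  bodyVelocity_conjTranspose h.contDiffOn_right (fun t ht => (h.isSVD t ht).unitary_right) ht

theorem IsSVDPath.svdDrive_eq (h : IsSVDPath 1 A U σ V) (ht : t ∈ Icc (0 : ℝ) 1) :
    svdDrive A U V t = bodyVelocity U t * sigmaMatrix (σ t) +
      sigmaMatrix (derivWithin σ (Icc 0 1) t) - sigmaMatrix (σ t) * bodyVelocity V t := by
  have hU := hasDerivWithinAt_bodyVelocity h.contDiffOn_left ht (h.isSVD t ht).unitary_left
  have hV := hasDerivWithinAt_bodyVelocity h.contDiffOn_right ht (h.isSVD t ht).unitary_right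
  have hσ : HasDerivWithinAt σ (derivWithin σ (Icc 0 1) t) (Icc 0 1) t :=
    (h.contDiffOn_sigma.differentiableOn (by simp) t ht).hasDerivWithinAt
  have hA : HasDerivWithinAt A _ (Icc 0 1) t :=
    ((hU.matrix_mul hσ.sigmaMatrix).matrix_mul hV.matrix_conjTranspose).congr
      (fun x hx => (h.isSVD x hx).eq) (h.isSVD t ht).eq
  have hA' : derivWithin A (Icc 0 1) t = _ :=
    hA.derivWithin (uniqueDiffOn_Icc zero_lt_one t ht)
  have hUU := unitary_conjTranspose_mul (h.isSVD t ht).unitary_left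
  have hVV := unitary_conjTranspose_mul (h.isSVD t ht).unitary_right
  have hU1 : ∀ M : Matrix (Fin n) (Fin n) ℂ, (U t)ᴴ * (U t * M) = M := fun M => by
    rw [← Matrix.mul_assoc, hUU, Matrix.one_mul]
  rw [svdDrive, hA', Matrix.conjTranspose_mul, h.skew_right ht]
  simp only [Matrix.mul_add, Matrix.add_mul, Matrix.mul_assoc, hVV, hU1, Matrix.mul_one,
    Matrix.neg_mul, Matrix.mul_neg]
  abel

/-- For j ≠ l, F_jl and the conjugate of F_lj form a 2×2 linear system for H_jl and K_jl with
determinant σ_l² - σ_j² ≠ 0. On the diagonal, H_jj and K_jj are imaginary and σ_j' is real, so the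
imaginary part of F_jj isolates σ_j (H_jj - K_jj). -/
theorem IsSVDPath.svdEquations (h : IsSVDPath 1 A U σ V)
    (hdistinct : ∀ t ∈ Icc (0 : ℝ) 1, StrictAnti (singularValue (A t)))
    (hpos : ∀ t ∈ Icc (0 : ℝ) 1, ∀ j, 0 < singularValue (A t) j) :
    SVDEquations A U σ V (bodyVelocity U) (bodyVelocity V) := by
  have hskew : ∀ {M : Matrix (Fin n) (Fin n) ℂ}, Mᴴ = -M → ∀ j l, star (M l j) = -M j l :=
    fun hM j l => congrFun (congrFun hM j) l
  have hF : ∀ t ∈ Icc (0 : ℝ) 1, ∀ j l, j ≠ l → svdDrive A U V t j l =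
      bodyVelocity U t j l * σ t l - σ t j * bodyVelocity V t j l := by
    intro t ht j l hjl
    rw [h.svdDrive_eq ht]
    simp [sigmaMatrix, Matrix.diagonal_apply_ne _ hjl]
  have hFs : ∀ t ∈ Icc (0 : ℝ) 1, ∀ j l, j ≠ l → star (svdDrive A U V t l j) =
      -(bodyVelocity U t j l * σ t j) + σ t l * bodyVelocity V t j l := by
    intro t ht j l hjl
    rw [hF t ht l j hjl.symm, star_sub, star_mul', star_mul', hskew (h.skew_left ht),
      hskew (h.skew_right ht)]
    simp
  have hden : ∀ t ∈ Icc (0 : ℝ) 1, ∀ j l, j ≠ l → (σ t l : ℂ) ^ 2 - (σ t j : ℂ) ^ 2 ≠ 0 := by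
    intro t ht j l hjl h0
    rw [h.sigma_eq ht] at h0
    have h1 : singularValue (A t) l ^ 2 = singularValue (A t) j ^ 2 := by
      exact_mod_cast sub_eq_zero.1 h0
    exact hjl ((hdistinct t ht).injective
      ((pow_left_inj₀ (hpos t ht l).le (hpos t ht j).le two_ne_zero).1 h1)).symm
  refine ⟨fun t ht => ?_, fun t ht => ?_, fun t ht => ?_, fun t ht => h.skew_left ht,
    fun t ht => h.skew_right ht, fun t ht j l hjl => ?_, fun t ht j l hjl => ?_, fun t ht j => ?_⟩
  · have hσ : HasDerivWithinAt σ (derivWithin σ (Icc 0 1) t) (Icc 0 1) t :=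
      (h.contDiffOn_sigma.differentiableOn (by simp) t ht).hasDerivWithinAt
    have heq : svdDrive A U V t - bodyVelocity U t * sigmaMatrix (σ t) +
        sigmaMatrix (σ t) * bodyVelocity V t = sigmaMatrix (derivWithin σ (Icc 0 1) t) := by
      rw [h.svdDrive_eq ht]
      abel
    rw [heq]
    exact hσ.sigmaMatrix
  · exact hasDerivWithinAt_bodyVelocity h.contDiffOn_left ht (h.isSVD t ht).unitary_left
  · exact hasDerivWithinAt_bodyVelocity h.contDiffOn_right ht (h.isSVD t ht).unitary_right
  · rw [eq_div_iff (hden t ht j l hjl), hF t ht j l hjl, hFs t ht j l hjl]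
    ring
  · rw [eq_div_iff (hden t ht j l hjl), hF t ht j l hjl, hFs t ht j l hjl]
    ring
  · have hσ0 : (σ t j : ℂ) ≠ 0 := by
      rw [h.sigma_eq ht]
      exact_mod_cast (hpos t ht j).ne'
    have hre : ∀ {M : Matrix (Fin n) (Fin n) ℂ}, Mᴴ = -M → (M j j).re = 0 := fun {M} hM => by
      have := congrArg Complex.re (hskew hM j j)
      simp at this
      linarith
    have hFjj : svdDrive A U V t j j = bodyVelocity U t j j * σ t j +
        (derivWithin σ (Icc 0 1) t j : ℂ) - σ t j * bodyVelocity V t j j := by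
      rw [h.svdDrive_eq ht]
      simp [sigmaMatrix]
    rw [eq_div_iff hσ0, hFjj]
    apply Complex.ext
    · simp [hre (h.skew_left ht), hre (h.skew_right ht)]
    · simp [hre (h.skew_left ht), hre (h.skew_right ht)]
      ring

end SVDPaths

/-! ### Phase freedom, the balanced gauge and minimality. -/

section JointVariation

variable {n : ℕ} {k m : ℕ∞} {A U V P Q : ℝ → Matrix (Fin n) (Fin n) ℂ} {σ τ : ℝ → Fin n → ℝ}
  {t : ℝ}

/-- Two singular value decompositions with simple, nonzero singular values differ by a common
diagonal unitary factor. -/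
theorem IsSVD.exists_phase {A U V P Q : Matrix (Fin n) (Fin n) ℂ} {s : Fin n → ℝ}
    (h : IsSVD A U s V) (h' : IsSVD A P s Q) (hs : StrictAnti s) (hpos : ∀ j, 0 < s j) :
    ∃ e : Fin n → ℂ, (∀ j, star (e j) * e j = 1) ∧
      P = U * Matrix.diagonal e ∧ Q = V * Matrix.diagonal e := by
  have hVV := unitary_mul_conjTranspose h.unitary_right
  have hVV' := unitary_conjTranspose_mul h.unitary_right
  have hQQ := unitary_conjTranspose_mul h'.unitary_right
  set E : Matrix (Fin n) (Fin n) ℂ := Vᴴ * Q with hE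
  have hQE : Q = V * E := by rw [hE, ← Matrix.mul_assoc, hVV, Matrix.one_mul]
  -- V and Q both diagonalize A*A, so E commutes with Σ². The entries of Σ² are distinct, which
  -- makes E diagonal.
  have hcomm : Matrix.diagonal (fun j => ((s j ^ 2 : ℝ) : ℂ)) * E =
      E * Matrix.diagonal (fun j => ((s j ^ 2 : ℝ) : ℂ)) := by
    have h1 := h.conjTranspose_mul_self.symm.trans h'.conjTranspose_mul_self
    calc _ = Vᴴ * (V * Matrix.diagonal (fun j => ((s j ^ 2 : ℝ) : ℂ)) * Vᴴ) * Q := by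
          rw [hE]
          simp only [← Matrix.mul_assoc, hVV', Matrix.one_mul]
      _ = _ := by
          rw [h1, hE]
          simp only [Matrix.mul_assoc, hQQ, Matrix.mul_one]
  have hdiag : E = Matrix.diagonal fun j => E j j := by
    ext i j
    by_cases hij : i = j
    · subst hij; simp
    · rw [Matrix.diagonal_apply_ne _ hij]
      have h2 := congrFun (congrFun hcomm i) j
      rw [Matrix.diagonal_mul, Matrix.mul_diagonal] at h2
      have h3 : ((s i ^ 2 : ℝ) : ℂ) - ((s j ^ 2 : ℝ) : ℂ) ≠ 0 := by
        intro h0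
        have h4 : s i ^ 2 = s j ^ 2 := by exact_mod_cast sub_eq_zero.1 h0
        exact hij (hs.injective
          ((pow_left_inj₀ (hpos i).le (hpos j).le two_ne_zero).1 h4))
      have h5 : (((s i ^ 2 : ℝ) : ℂ) - ((s j ^ 2 : ℝ) : ℂ)) * E i j = 0 := by
        linear_combination h2
      exact (mul_eq_zero.1 h5).resolve_left h3
  have hEE : Eᴴ * E = 1 := by
    rw [hE, Matrix.conjTranspose_mul, Matrix.conjTranspose_conjTranspose, Matrix.mul_assoc,
      ← Matrix.mul_assoc V, hVV, Matrix.one_mul, hQQ]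
  refine ⟨fun j => E j j, fun j => ?_, ?_, ?_⟩
  · have h1 := congrFun (congrFun hEE j) j
    rw [hdiag] at h1
    simpa using h1
  · have h1 : P * sigmaMatrix s = U * Matrix.diagonal (fun j => E j j) * sigmaMatrix s := by
      calc P * sigmaMatrix s = A * Q := by
            rw [h'.eq, Matrix.mul_assoc, hQQ, Matrix.mul_one]
        _ = U * sigmaMatrix s * E := by
            rw [h.eq, hE, Matrix.mul_assoc]
        _ = _ := by
            rw [hdiag, sigmaMatrix, Matrix.mul_assoc, Matrix.mul_assoc,
              Matrix.diagonal_mul_diagonal, Matrix.diagonal_mul_diagonal]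
            simp [mul_comm]
    have h2 := congrArg (· * sigmaMatrix (fun j => (s j)⁻¹)) h1
    simpa only [Matrix.mul_assoc, sigmaMatrix_mul_sigmaMatrix_inv hpos, Matrix.mul_one] using h2
  · rw [← hdiag, hQE]

/-- The body velocities of two singular value decompositions of the same path. -/
theorem IsSVDPath.exists_phase (h : IsSVDPath 1 A U σ V) (h' : IsSVDPath 1 A P τ Q)
    (hdistinct : ∀ t ∈ Icc (0 : ℝ) 1, StrictAnti (singularValue (A t)))
    (hpos : ∀ t ∈ Icc (0 : ℝ) 1, ∀ j, 0 < singularValue (A t) j) (ht : t ∈ Icc (0 : ℝ) 1) :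
    ∃ e : Fin n → ℂ, (∀ j, star (e j) * e j = 1) ∧
      P t = U t * Matrix.diagonal e ∧ Q t = V t * Matrix.diagonal e ∧
      (∀ j l, j ≠ l → bodyVelocity P t j l = star (e j) * bodyVelocity U t j l * e l) ∧
      (∀ j l, j ≠ l → bodyVelocity Q t j l = star (e j) * bodyVelocity V t j l * e l) ∧
      ∀ j, bodyVelocity P t j j - bodyVelocity Q t j j =
        bodyVelocity U t j j - bodyVelocity V t j j := by
  have hστ : τ t = σ t := (h'.sigma_eq ht).trans (h.sigma_eq ht).symm
  have hs := h'.isSVD t ht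
  rw [hστ] at hs
  obtain ⟨e, he, hP, hQ⟩ := (h.isSVD t ht).exists_phase hs
    (by rw [h.sigma_eq ht]; exact hdistinct t ht) (by rw [h.sigma_eq ht]; exact hpos t ht)
  have hF : ∀ j l, svdDrive A P Q t j l = star (e j) * svdDrive A U V t j l * e l := by
    intro j l
    have : svdDrive A P Q t = (Matrix.diagonal e)ᴴ * svdDrive A U V t * Matrix.diagonal e := by
      rw [svdDrive, svdDrive, hP, hQ, Matrix.conjTranspose_mul]
      simp only [Matrix.mul_assoc]
    rw [this, Matrix.mul_diagonal, Matrix.diagonal_conjTranspose, Matrix.diagonal_mul, Pi.star_apply]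
  have hFs : ∀ j l, star (svdDrive A P Q t l j) = star (e j) * star (svdDrive A U V t l j) * e l := by
    intro j l
    rw [hF, star_mul', star_mul', star_star]
    ring
  have hUV := h.svdEquations hdistinct hpos
  have hPQ := h'.svdEquations hdistinct hpos
  refine ⟨e, he, hP, hQ, fun j l hjl => ?_, fun j l hjl => ?_, fun j => ?_⟩
  · rw [hUV.offdiag_left t ht j l hjl, hPQ.offdiag_left t ht j l hjl, hστ, hF, hFs]
    ring
  · rw [hUV.offdiag_right t ht j l hjl, hPQ.offdiag_right t ht j l hjl, hστ, hFs, hF]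
    ring
  · rw [hUV.diag_sub t ht j, hPQ.diag_sub t ht j, hστ, hF, mul_right_comm, he, one_mul]

/-- By the parallelogram law 2(|a|² + |b|²) - |a + b|² = |a - b|² on the diagonal, the expression
involves only off-diagonal moduli and diagonal differences, the data that a phase change preserves.
-/
theorem two_mul_norm_sq_add_norm_sq_sub_eq {H K H' K' : Matrix (Fin n) (Fin n) ℂ}
    (hH : ∀ j l, j ≠ l → ‖H' j l‖ = ‖H j l‖) (hK : ∀ j l, j ≠ l → ‖K' j l‖ = ‖K j l‖)
    (hd : ∀ j, H' j j - K' j j = H j j - K j j) :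
    2 * (‖H'‖ ^ 2 + ‖K'‖ ^ 2) - ∑ j, ‖H' j j + K' j j‖ ^ 2 =
      2 * (‖H‖ ^ 2 + ‖K‖ ^ 2) - ∑ j, ‖H j j + K j j‖ ^ 2 := by
  have key : ∀ H K : Matrix (Fin n) (Fin n) ℂ,
      2 * (‖H‖ ^ 2 + ‖K‖ ^ 2) - ∑ j, ‖H j j + K j j‖ ^ 2 =
        ∑ i, ∑ j, if i = j then ‖H i i - K i i‖ ^ 2 else 2 * (‖H i j‖ ^ 2 + ‖K i j‖ ^ 2) := by
    intro H K
    rw [frobenius_norm_sq, frobenius_norm_sq, ← Finset.sum_add_distrib, Finset.mul_sum,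
      ← Finset.sum_sub_distrib]
    refine Finset.sum_congr rfl fun i _ => ?_
    have hdelta : ‖H i i + K i i‖ ^ 2 = ∑ j, if i = j then ‖H i i + K i i‖ ^ 2 else 0 := by
      simp
    rw [← Finset.sum_add_distrib, Finset.mul_sum, sub_eq_iff_eq_add, hdelta,
      ← Finset.sum_add_distrib]
    refine Finset.sum_congr rfl fun j _ => ?_
    split_ifs with hij
    · subst hij
      have := parallelogram_law_with_norm ℝ (H i i) (K i i)
      nlinarith
    · ring
  rw [key, key]
  refine Finset.sum_congr rfl fun i _ => Finset.sum_congr rfl fun j _ => ?_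
  split_ifs with hij
  · rw [hd]
  · rw [hH i j hij, hK i j hij]

/-- The integrand of the joint variation. -/
def jointSpeed (U V : ℝ → Matrix (Fin n) (Fin n) ℂ) (t : ℝ) : ℝ :=
  √(‖derivWithin U (Icc 0 1) t‖ ^ 2 + ‖derivWithin V (Icc 0 1) t‖ ^ 2)

theorem IsSVDPath.continuousOn_jointSpeed (h : IsSVDPath 1 A U σ V) :
    ContinuousOn (jointSpeed U V) (Icc 0 1) := by
  have hU : ContinuousOn (fun t => ‖derivWithin U (Icc 0 1) t‖) (Icc 0 1) :=
    (ContDiffOn.continuousOn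
      (ContDiffOn.derivWithin_matrix (m := 0) (by simpa using h.contDiffOn_left))).norm
  have hV : ContinuousOn (fun t => ‖derivWithin V (Icc 0 1) t‖) (Icc 0 1) :=
    (ContDiffOn.continuousOn
      (ContDiffOn.derivWithin_matrix (m := 0) (by simpa using h.contDiffOn_right))).norm
  exact ((hU.pow 2).add (hV.pow 2)).sqrt

/-- The diagonal gauge condition `Hⱼⱼ + Kⱼⱼ = 0` on `[0,1]`. -/
def IsBalanced (U V : ℝ → Matrix (Fin n) (Fin n) ℂ) : Prop :=
  ∀ t ∈ Icc (0 : ℝ) 1, ∀ j, bodyVelocity U t j j + bodyVelocity V t j j = 0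

theorem IsSVDPath.jointSpeed_sq (h : IsSVDPath 1 A U σ V) (h' : IsSVDPath 1 A P τ Q)
    (hdistinct : ∀ t ∈ Icc (0 : ℝ) 1, StrictAnti (singularValue (A t)))
    (hpos : ∀ t ∈ Icc (0 : ℝ) 1, ∀ j, 0 < singularValue (A t) j) (hbal : IsBalanced U V)
    (ht : t ∈ Icc (0 : ℝ) 1) :
    jointSpeed P Q t ^ 2 = jointSpeed U V t ^ 2 +
      (∑ j, ‖bodyVelocity P t j j + bodyVelocity Q t j j‖ ^ 2) / 2 := by
  obtain ⟨e, he, -, -, hH, hK, hd⟩ := h.exists_phase h' hdistinct hpos ht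
  have hnorm : ∀ j, ‖e j‖ = 1 := by
    intro j
    have h1 := congrArg norm (he j)
    rw [norm_mul, norm_star, norm_one] at h1
    nlinarith [norm_nonneg (e j)]
  have key := two_mul_norm_sq_add_norm_sq_sub_eq
    (H := bodyVelocity U t) (K := bodyVelocity V t) (H' := bodyVelocity P t)
    (K' := bodyVelocity Q t)
    (fun j l hjl => by rw [hH j l hjl, norm_mul, norm_mul, norm_star, hnorm, hnorm]; ring)
    (fun j l hjl => by rw [hK j l hjl, norm_mul, norm_mul, norm_star, hnorm, hnorm]; ring) hd
  simp only [hbal t ht, norm_zero] at key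
  rw [jointSpeed, jointSpeed, Real.sq_sqrt (by positivity), Real.sq_sqrt (by positivity),
    norm_derivWithin_sq (h.isSVD t ht).unitary_left, norm_derivWithin_sq (h.isSVD t ht).unitary_right,
    norm_derivWithin_sq (h'.isSVD t ht).unitary_left,
    norm_derivWithin_sq (h'.isSVD t ht).unitary_right]
  simp at key
  linarith

theorem jointSpeed_nonneg (U V : ℝ → Matrix (Fin n) (Fin n) ℂ) (t : ℝ) :
    0 ≤ jointSpeed U V t := Real.sqrt_nonneg _

theorem IsSVDPath.jointSpeed_le (h : IsSVDPath 1 A U σ V) (h' : IsSVDPath 1 A P τ Q)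
    (hdistinct : ∀ t ∈ Icc (0 : ℝ) 1, StrictAnti (singularValue (A t)))
    (hpos : ∀ t ∈ Icc (0 : ℝ) 1, ∀ j, 0 < singularValue (A t) j) (hbal : IsBalanced U V)
    (ht : t ∈ Icc (0 : ℝ) 1) : jointSpeed U V t ≤ jointSpeed P Q t := by
  refine le_of_sq_le_sq ?_ (jointSpeed_nonneg P Q t)
  rw [h.jointSpeed_sq h' hdistinct hpos hbal ht]
  exact le_add_of_nonneg_right (by positivity)

theorem IsSVDPath.jointVariation_le_of_isBalanced (h : IsSVDPath 1 A U σ V)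
    (h' : IsSVDPath 1 A P τ Q)
    (hdistinct : ∀ t ∈ Icc (0 : ℝ) 1, StrictAnti (singularValue (A t)))
    (hpos : ∀ t ∈ Icc (0 : ℝ) 1, ∀ j, 0 < singularValue (A t) j) (hbal : IsBalanced U V) :
    jointVariation U V ≤ jointVariation P Q := by
  refine intervalIntegral.integral_mono_on zero_le_one ?_ ?_
    fun t ht => h.jointSpeed_le h' hdistinct hpos hbal ht
  · exact h.continuousOn_jointSpeed.intervalIntegrable_of_Icc zero_le_one
  · exact h'.continuousOn_jointSpeed.intervalIntegrable_of_Icc zero_le_one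

/-- A nonzero sum at one time makes the continuous integrand strictly larger there, hence the
integral too. -/
theorem IsSVDPath.isBalanced_of_jointVariation_le (h : IsSVDPath 1 A U σ V)
    (h' : IsSVDPath 1 A P τ Q)
    (hdistinct : ∀ t ∈ Icc (0 : ℝ) 1, StrictAnti (singularValue (A t)))
    (hpos : ∀ t ∈ Icc (0 : ℝ) 1, ∀ j, 0 < singularValue (A t) j) (hbal : IsBalanced U V)
    (hle : jointVariation P Q ≤ jointVariation U V) : IsBalanced P Q := by
  intro t ht j
  by_contra hne
  refine hle.not_gt ?_
  refine intervalIntegral.integral_lt_integral_of_continuousOn_of_le_of_exists_lt zero_lt_one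
    h.continuousOn_jointSpeed h'.continuousOn_jointSpeed
    (fun s hs => h.jointSpeed_le h' hdistinct hpos hbal (Ioc_subset_Icc_self hs)) ⟨t, ht, ?_⟩
  refine lt_of_pow_lt_pow_left₀ 2 (jointSpeed_nonneg P Q t) ?_
  change jointSpeed U V t ^ 2 < jointSpeed P Q t ^ 2
  rw [h.jointSpeed_sq h' hdistinct hpos hbal ht]
  refine lt_add_of_pos_right _ (half_pos ?_)
  exact Finset.sum_pos' (fun _ _ => by positivity)
    ⟨j, Finset.mem_univ j, pow_pos (norm_pos_iff.2 hne) 2⟩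

/-- A balanced decomposition is determined by its initial factors. -/
theorem IsSVDPath.eqOn_of_isBalanced (h : IsSVDPath 1 A U σ V) (h' : IsSVDPath 1 A P τ Q)
    (hdistinct : ∀ t ∈ Icc (0 : ℝ) 1, StrictAnti (singularValue (A t)))
    (hpos : ∀ t ∈ Icc (0 : ℝ) 1, ∀ j, 0 < singularValue (A t) j) (hbal : IsBalanced U V)
    (hbal' : IsBalanced P Q) (h0 : P 0 = U 0) :
    EqOn P U (Icc 0 1) ∧ EqOn Q V (Icc 0 1) := by
  have h0mem : (0 : ℝ) ∈ Icc (0 : ℝ) 1 := ⟨le_rfl, zero_le_one⟩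
  have hone : ∀ t ∈ Icc (0 : ℝ) 1, (U t)ᴴ * P t = 1 := by
    intro t ht
    -- The relative phase U*P has derivative -HD + DH' with D = diag(e), H and H' the body
    -- velocities of U and P. This vanishes because H' = D*HD.
    have key := eq_zero_of_linear_ode (G := fun _ => 0) (W := fun t => (U t)ᴴ * P t - 1)
      continuousOn_const ?_ ?_ t ht
    · exact sub_eq_zero.1 key
    · intro t ht
      obtain ⟨e, he, hP, -, hH, -, hd⟩ := h.exists_phase h' hdistinct hpos ht
      have hD : (U t)ᴴ * P t = Matrix.diagonal e := by
        rw [hP, ← Matrix.mul_assoc, unitary_conjTranspose_mul (h.isSVD t ht).unitary_left,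
          Matrix.one_mul]
      -- The diagonal differences agree and both sums vanish, so the entries themselves agree.
      have hdiag : ∀ j, bodyVelocity P t j j = bodyVelocity U t j j := by
        intro j
        linear_combination (1 / 2) * hd j + (1 / 2) * hbal' t ht j - (1 / 2) * hbal t ht j
      have hcomm : Matrix.diagonal e * bodyVelocity P t =
          bodyVelocity U t * Matrix.diagonal e := by
        ext j l
        rw [Matrix.diagonal_mul, Matrix.mul_diagonal]
        by_cases hjl : j = l
        · subst hjl; rw [hdiag, mul_comm]
        · rw [hH j l hjl]
          linear_combination bodyVelocity U t j l * e l * he j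
      have hU := hasDerivWithinAt_bodyVelocity h.contDiffOn_left ht (h.isSVD t ht).unitary_left
      have hP' := hasDerivWithinAt_bodyVelocity h'.contDiffOn_left ht
        (h'.isSVD t ht).unitary_left
      have h1 := (hU.matrix_conjTranspose.matrix_mul hP').sub_const
        (1 : Matrix (Fin n) (Fin n) ℂ)
      have h2 : (U t * bodyVelocity U t)ᴴ * P t + (U t)ᴴ * (P t * bodyVelocity P t) =
          0 * ((U t)ᴴ * P t - 1) := by
        rw [Matrix.conjTranspose_mul, Matrix.mul_assoc, ← Matrix.mul_assoc _ (P t), hD, hcomm,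
          h.skew_left ht, Matrix.neg_mul, neg_add_cancel, Matrix.zero_mul]
      rw [← h2]
      exact h1
    · simp only [h0, unitary_conjTranspose_mul (h.isSVD 0 h0mem).unitary_left, sub_self]
  have hphase : ∀ t ∈ Icc (0 : ℝ) 1, P t = U t ∧ Q t = V t := by
    intro t ht
    obtain ⟨e, -, hP, hQ, -⟩ := h.exists_phase h' hdistinct hpos ht
    have hD : Matrix.diagonal e = 1 := by
      rw [← hone t ht, hP, ← Matrix.mul_assoc,
        unitary_conjTranspose_mul (h.isSVD t ht).unitary_left, Matrix.one_mul]
    rw [hP, hQ, hD, Matrix.mul_one, Matrix.mul_one]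
    exact ⟨rfl, rfl⟩
  exact ⟨fun t ht => (hphase t ht).1, fun t ht => (hphase t ht).2⟩

/-- A diagonal phase turns any decomposition into a balanced one with the same initial factors. -/
theorem IsSVDPath.exists_isBalanced (h : IsSVDPath (m + 1) A U σ V) :
    ∃ P Q : ℝ → Matrix (Fin n) (Fin n) ℂ,
      IsSVDPath (m + 1) A P σ Q ∧ IsBalanced P Q ∧ P 0 = U 0 ∧ Q 0 = V 0 := by
  have h1 : IsSVDPath 1 A U σ V := h.of_le le_add_self
  have hle : (m : WithTop ℕ∞) ≤ ((m + 1 : ℕ∞) : WithTop ℕ∞) := by push_cast; exact le_self_add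
  have hHd : ContDiffOn ℝ m (bodyVelocity U) (Icc 0 1) :=
    (h.contDiffOn_left.of_le hle).matrix_conjTranspose.matrix_mul
      h.contDiffOn_left.derivWithin_matrix
  have hKd : ContDiffOn ℝ m (bodyVelocity V) (Icc 0 1) :=
    (h.contDiffOn_right.of_le hle).matrix_conjTranspose.matrix_mul
      h.contDiffOn_right.derivWithin_matrix
  -- A phase with logarithmic derivative ρ adds ρ_j to both H_jj and K_jj. This choice makes the new
  -- sum zero; it is imaginary, so the phase stays unitary.
  set ρ : ℝ → Fin n → ℂ :=
    fun t j => (-1 / 2) * (bodyVelocity U t j j + bodyVelocity V t j j) with hρ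
  set G : ℝ → Matrix (Fin n) (Fin n) ℂ := fun t => Matrix.diagonal (ρ t) with hG
  have hGd : ContDiffOn ℝ m G (Icc 0 1) := ContDiffOn.matrix_diagonal fun j =>
    contDiffOn_const.mul ((contDiffOn_matrix_iff.1 hHd j j).add (contDiffOn_matrix_iff.1 hKd j j))
  have hGskew : ∀ t ∈ Icc (0 : ℝ) 1, (G t)ᴴ + G t = 0 := by
    intro t ht
    have hH : ∀ j, star (bodyVelocity U t j j) = -bodyVelocity U t j j :=
      fun j => congrFun (congrFun (h1.skew_left ht) j) j
    have hK : ∀ j, star (bodyVelocity V t j j) = -bodyVelocity V t j j :=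
      fun j => congrFun (congrFun (h1.skew_right ht) j) j
    rw [hG, Matrix.diagonal_conjTranspose, Matrix.diagonal_add, ← Matrix.diagonal_zero]
    congr 1
    funext j
    rw [hρ, Pi.star_apply, star_mul', star_add, hH, hK]
    simp
    ring
  obtain ⟨D₀, hD₀0, hD₀⟩ := exists_linear_ode_solution hGd.continuousOn 1
  -- As G is diagonal, the diagonal entries of the solution satisfy the equation by themselves, so
  -- its diagonal part can be used directly.
  set e : ℝ → Fin n → ℂ := fun t j => D₀ t j j with he
  set D : ℝ → Matrix (Fin n) (Fin n) ℂ := fun t => Matrix.diagonal (e t) with hD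
  have hD0 : D 0 = 1 := by
    simp [hD, he, hD₀0]
  have hDode : ∀ t ∈ Icc (0 : ℝ) 1, HasDerivWithinAt D (G t * D t) (Icc 0 1) t := by
    intro t ht
    refine hasDerivWithinAt_matrix_iff.2 fun i j => ?_
    have hij := hasDerivWithinAt_matrix_iff.1 (hD₀ t ht) i j
    by_cases heq : i = j
    · subst heq
      simpa [hD, hG, he] using hij
    · simpa [hD, hG, Matrix.diagonal_apply_ne _ heq] using
        hasDerivWithinAt_const t (Icc (0 : ℝ) 1) (0 : ℂ)
  have hDd := contDiffOn_of_linear_ode hGd hDode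
  have hDu : ∀ t ∈ Icc (0 : ℝ) 1, D t ∈ Matrix.unitaryGroup (Fin n) ℂ :=
    fun t ht => unitary_of_linear_ode hGskew hDode (hD0 ▸ one_mem _) ht
  have hes : ∀ t ∈ Icc (0 : ℝ) 1, ∀ j, star (e t j) * e t j = 1 := by
    intro t ht j
    have := congrFun (congrFun (unitary_conjTranspose_mul (hDu t ht)) j) j
    simpa [hD] using this
  have hvel : ∀ M : ℝ → Matrix (Fin n) (Fin n) ℂ,
      ContDiffOn ℝ ((1 : ℕ∞) : WithTop ℕ∞) M (Icc 0 1) →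
      (∀ t ∈ Icc (0 : ℝ) 1, M t ∈ Matrix.unitaryGroup (Fin n) ℂ) →
      ∀ t ∈ Icc (0 : ℝ) 1, ∀ j,
        bodyVelocity (fun t => M t * D t) t j j = bodyVelocity M t j j + ρ t j := by
    intro M hM hMu t ht j
    have h2 : bodyVelocity (fun t => M t * D t) t =
        (D t)ᴴ * (bodyVelocity M t * D t + G t * D t) := by
      refine bodyVelocity_eq ht (mul_mem (hMu t ht) (hDu t ht)) ?_
      have h3 := (hasDerivWithinAt_bodyVelocity hM ht (hMu t ht)).matrix_mul (hDode t ht)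
      have h4 : M t * D t * ((D t)ᴴ * (bodyVelocity M t * D t + G t * D t)) =
          M t * bodyVelocity M t * D t + M t * (G t * D t) := by
        rw [Matrix.mul_assoc, ← Matrix.mul_assoc (D t), unitary_mul_conjTranspose (hDu t ht),
          Matrix.one_mul, Matrix.mul_add, Matrix.mul_assoc]
      rw [h4]
      exact h3
    rw [h2, ← Matrix.add_mul, hD, Matrix.diagonal_conjTranspose, Matrix.diagonal_mul,
      Matrix.mul_diagonal, Matrix.add_apply, show G t j j = ρ t j from Matrix.diagonal_apply_eq _ _,
      Pi.star_apply]
    linear_combination (bodyVelocity M t j j + ρ t j) * hes t ht j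
  refine ⟨fun t => U t * D t, fun t => V t * D t,
    ⟨h.contDiffOn_left.matrix_mul hDd, h.contDiffOn_sigma, h.contDiffOn_right.matrix_mul hDd,
      fun t ht => ?_⟩, fun t ht j => ?_, ?_, ?_⟩
  · have hs := h.isSVD t ht
    refine ⟨mul_mem hs.unitary_left (hDu t ht), mul_mem hs.unitary_right (hDu t ht), hs.nonneg,
      hs.antitone, ?_⟩
    have hcomm : D t * sigmaMatrix (σ t) = sigmaMatrix (σ t) * D t := by
      simp [hD, sigmaMatrix, mul_comm]
    rw [Matrix.mul_assoc (U t), hcomm, Matrix.conjTranspose_mul, Matrix.mul_assoc,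
      Matrix.mul_assoc, ← Matrix.mul_assoc (D t), unitary_mul_conjTranspose (hDu t ht),
      Matrix.one_mul, ← Matrix.mul_assoc]
    exact hs.eq
  · rw [hvel U h1.contDiffOn_left (fun t ht => (h.isSVD t ht).unitary_left) t ht j,
      hvel V h1.contDiffOn_right (fun t ht => (h.isSVD t ht).unitary_right) t ht j, hρ]
    ring
  · simp [hD0]
  · simp [hD0]

end JointVariation

end

/-! ### Minimizers are the balanced decompositions. -/

theorem theorem3p5 (n : ℕ) (k : ℕ∞) (hk : 1 ≤ k)
    (A : ℝ → Matrix (Fin n) (Fin n) ℂ) (hA : ContDiffOn ℝ k A (Icc 0 1))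
    (hdistinct : ∀ t ∈ Icc (0 : ℝ) 1, StrictAnti (singularValue (A t)))
    (hpos : ∀ t ∈ Icc (0 : ℝ) 1, ∀ j, 0 < singularValue (A t) j) :
    (∀ (U₀ : Matrix (Fin n) (Fin n) ℂ) (σ₀ : Fin n → ℝ) (V₀ : Matrix (Fin n) (Fin n) ℂ),
      IsSVD (A 0) U₀ σ₀ V₀ →
      ∃ (U : ℝ → Matrix (Fin n) (Fin n) ℂ) (σ : ℝ → Fin n → ℝ)
        (V : ℝ → Matrix (Fin n) (Fin n) ℂ),
        (IsJointMVD k A U σ V ∧ U 0 = U₀ ∧ σ 0 = σ₀ ∧ V 0 = V₀) ∧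
        ∀ (P : ℝ → Matrix (Fin n) (Fin n) ℂ) (τ : ℝ → Fin n → ℝ)
          (Q : ℝ → Matrix (Fin n) (Fin n) ℂ),
          IsJointMVD k A P τ Q → P 0 = U₀ → τ 0 = σ₀ → Q 0 = V₀ →
            EqOn P U (Icc 0 1) ∧ EqOn τ σ (Icc 0 1) ∧ EqOn Q V (Icc 0 1)) ∧
    (∀ (U : ℝ → Matrix (Fin n) (Fin n) ℂ) (σ : ℝ → Fin n → ℝ)
      (V : ℝ → Matrix (Fin n) (Fin n) ℂ),
      IsSVDPath k A U σ V →
      (IsJointMVD k A U σ V ↔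
        ∃ H K : ℝ → Matrix (Fin n) (Fin n) ℂ,
          SVDEquations A U σ V H K ∧
            ∀ t ∈ Icc (0 : ℝ) 1, ∀ j, H t j j + K t j j = 0)) := by
  have h0 : (0 : ℝ) ∈ Icc (0 : ℝ) 1 := ⟨le_rfl, zero_le_one⟩
  -- For k = ∞ this gives m = ∞, since ∞ = ∞ + 1.
  obtain ⟨m, rfl⟩ : ∃ m : ℕ∞, k = m + 1 := ⟨k - 1, (tsub_add_cancel_of_le hk).symm⟩
  have hexists : ∀ (U₀ : Matrix (Fin n) (Fin n) ℂ) (σ₀ : Fin n → ℝ)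
      (V₀ : Matrix (Fin n) (Fin n) ℂ), IsSVD (A 0) U₀ σ₀ V₀ →
      ∃ U V : ℝ → Matrix (Fin n) (Fin n) ℂ,
        IsSVDPath (m + 1) A U (fun t => singularValue (A t)) V ∧ IsBalanced U V ∧
          U 0 = U₀ ∧ V 0 = V₀ := by
    intro U₀ σ₀ V₀ h₀
    obtain ⟨U, V, hUV, hU, hV⟩ := exists_isSVDPath hA hdistinct hpos h₀
    obtain ⟨P, Q, hPQ, hbal, hP, hQ⟩ := hUV.exists_isBalanced
    exact ⟨P, Q, hPQ, hbal, hP.trans hU, hQ.trans hV⟩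
  have hmin : ∀ {U V σ}, IsSVDPath (m + 1) A U σ V → IsBalanced U V →
      IsJointMVD (m + 1) A U σ V := fun h hbal =>
    ⟨h, fun _ _ _ h' =>
      (h.of_le hk).jointVariation_le_of_isBalanced h' hdistinct hpos hbal⟩
  have hbalanced : ∀ {U V σ}, IsJointMVD (m + 1) A U σ V → IsBalanced U V := by
    intro U V σ h
    -- Any balanced competitor suffices; the factors at 0 supply one.
    obtain ⟨P, Q, hPQ, hbal, -⟩ := hexists _ _ _ (h.1.isSVD 0 h0)
    exact (hPQ.of_le hk).isBalanced_of_jointVariation_le (h.1.of_le hk) hdistinct hpos hbal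
      (h.2 _ _ _ (hPQ.of_le hk))
  refine ⟨fun U₀ σ₀ V₀ h₀ => ?_, fun U σ V h => ⟨fun hmvd => ?_, ?_⟩⟩
  · obtain ⟨U, V, hUV, hbal, hU, hV⟩ := hexists U₀ σ₀ V₀ h₀
    refine ⟨U, fun t => singularValue (A t), V,
      ⟨hmin hUV hbal, hU, h₀.eq_singularValue.symm, hV⟩, fun P τ Q hPQ hP _ _ => ?_⟩
    obtain ⟨hPU, hQV⟩ := (hUV.of_le hk).eqOn_of_isBalanced (hPQ.1.of_le hk) hdistinct hpos hbal
      (hbalanced hPQ) (hP.trans hU.symm)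
    exact ⟨hPU, fun t ht => hPQ.1.sigma_eq ht, hQV⟩
  · exact ⟨bodyVelocity U, bodyVelocity V, (h.of_le hk).svdEquations hdistinct hpos,
      hbalanced hmvd⟩
  · rintro ⟨H, K, hHK, hdiag⟩
    refine hmin h fun t ht j => ?_
    -- U' = UH and V' = VK identify H and K with the body velocities, so the diagonal condition is
    -- exactly balance.
    rw [bodyVelocity_eq ht (h.isSVD t ht).unitary_left (hHK.deriv_left t ht),
      bodyVelocity_eq ht (h.isSVD t ht).unitary_right (hHK.deriv_right t ht)]
    exact hdiag t ht j
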